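/- **Setting.** Let $X\subseteq\mathbb R^d$ be a convex set with nonempty interior, $0\in X$, and let $C\subseteq X$ be nonempty, convex and compact. Let $\tilde F(x,z)$ be a stochastic function and $p(z;x)$, $x\in X$, positive probability densities with respect to a $\sigma$-finite measure, with $\tilde F(\cdot,z)$ and $\log p(z;\cdot)$ twice continuously differentiable on $X$ (all of this measurable in $z$), and let $F(x)=\mathbb E_{z\sim p(\cdot;x)}[\tilde F(x,z)]$. Derivatives are taken in $x$, within $X$; matrices carry the operator norm. Assume, for all $x,y\in X$ and all $z$: 1. (diameter) $\|u-w\|\le D$ for all $u,w\in C\cup\{0\}$; 2. $F(0)\ge 0$; 3. $|\tilde F(x,z)|\le B$, $\|\nabla\tilde F(x,z)\|\le G_{\tilde F}$, $\|\nabla^2\tilde F(x,z)\|\le L_{\tilde F}$; 4. $\mathbb E_{z\sim p(\cdot;x)}\|\nabla\log p(z;x)\|^4\le G_p^4$ and $\mathbb E_{z\sim p(\cdot;x)}\|\nabla^2\log p(z;x)\|^2\le L_p^2$, with $G_p\ge0$; 5. $\|\nabla^2\tilde F(x,z)-\nabla^2\tilde F(y,z)\|\le L_{2,\tilde F}\|x-y\|$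 and $\|\nabla^2\log p(z;x)-\nabla^2\log p(z;y)\|\le L_{2,p}\|x-y\|$. Let $L$ satisfy $L^2\ge 4B^2G_p^4+16G_{\tilde F}^2G_p^2+4L_{\tilde F}^2+4B^2L_p^2$. **Algorithm (SCG++).** Let $T\ge2$ and $x_0=0$. The first estimate is $$\hat g_0=\frac1{|\mathcal M_0|}\sum_{z\in\mathcal M_0}\big(\nabla\tilde F(x_0,z)+\tilde F(x_0,z)\nabla\log p(z;x_0)\big),$$ where $\mathcal M_0$ consists of i.i.d. samples of $p(\cdot;x_0)$. For $1\le t\le T-1$, conditionally on the past, $\mathcal M_t$ consists of i.i.d. pairs $(a,z(a))$ with $a$ uniform on $[0,1]$ and $z(a)\sim p(\cdot;x(a))$, $x(a)=a x_t+(1-a)x_{t-1}$, and $$\hat g_t=\hat g_{t-1}+\Big(\frac1{|\mathcal M_t|}\sum_{(a,z(a))\in\mathcal M_t}\tilde\nabla^2F(x(a),z(a))\Big)(x_t-x_{t-1}),$$ where, with all terms evaluated at $(x,z)$, $$\tilde\nabla^2F=\tilde F\,\nabla\log p\,(\nabla\log p)^{\top}+\nabla\tilde F\,(\nabla\log p)^{\top}+\nabla\log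 p\,(\nabla\tilde F)^{\top}+\nabla^2\tilde F+\tilde F\,\nabla^2\log p .$$ For $0\le t\le T-1$, $v_t\in\arg\max_{v\in C}\langle\hat g_t,v\rangle$ is chosen measurably without knowledge of later samples, and $x_{t+1}=x_t+\frac1Tv_t$. All minibatches are nonempty, and $|\mathcal M_0|\,L^2D^2\ge(G_{\tilde F}+BG_p)^2$. **Claim.** For every $\delta>0$, $$\mathbb P\left(\sum_{t=0}^{T-1}\|\nabla F(x_t)-\hat g_t\|^2\le\delta^2\sum_{t=1}^{T-1}\frac{2L^2D^2}{t^2}\right)\ge 1-\frac{T}{\delta^2}.$$ -/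

import Mathlib

open MeasureTheory

noncomputable section

namespace SCGPlus

/-- The space `ℝ^d` with its Euclidean norm. -/
abbrev Vec (d : ℕ) : Type := EuclideanSpace ℝ (Fin d)

variable {d : ℕ} {Z : Type*} [MeasurableSpace Z] {Ω : Type*} [MeasurableSpace Ω]

/-- The distribution `p(z; x)` of the random variable `z` at the point `x`, given by its density
`p x` with respect to the reference measure `ν`. -/
def law (ν : Measure Z) (p : Vec d → Z → ℝ) (x : Vec d) : Measure Z :=
  ν.withDensity (fun z => ENNReal.ofReal (p x z))

/-- The objective `F(x) = 𝔼_{z ∼ p(z; x)} [F̃(x, z)]`. -/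
def objective (ν : Measure Z) (Ft p : Vec d → Z → ℝ) (x : Vec d) : ℝ :=
  ∫ z, Ft x z ∂(law ν p x)

/-- The gradient at `x` of a function on the domain `X` (one-sided at boundary points of `X`,
such as the origin when `X` is a box with corner `0`). -/
def grad (X : Set (Vec d)) (f : Vec d → ℝ) (x : Vec d) : Vec d :=
  gradientWithin f X x

/-- The Hessian at `x` of a function on the domain `X`, as a linear map; its norm is the
operator norm. -/
def hess (X : Set (Vec d)) (f : Vec d → ℝ) (x : Vec d) : Vec d →L[ℝ] Vec d :=
  fderivWithin ℝ (fun y => grad X f y) X x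

/-- The matrix `u wᵀ`, i.e. `h ↦ ⟨w, h⟩ u`. -/
def outer (u w : Vec d) : Vec d →L[ℝ] Vec d :=
  (innerSL ℝ w).smulRight u

/-- `∇ log p(z; x)`, the gradient being taken in `x`. -/
def score (X : Set (Vec d)) (p : Vec d → Z → ℝ) (x : Vec d) (z : Z) : Vec d :=
  grad X (fun y => Real.log (p y z)) x

/-- `∇² log p(z; x)`, the Hessian being taken in `x`. -/
def scoreHess (X : Set (Vec d)) (p : Vec d → Z → ℝ) (x : Vec d) (z : Z) :
    Vec d →L[ℝ] Vec d :=
  hess X (fun y => Real.log (p y z)) x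

/-- The unbiased one-sample estimate of `∇F(x)`:
`∇F̃(x, z) + F̃(x, z) ∇ log p(z; x)` (which is `∇F̃(x, z)` if `p` does not depend on `x`). -/
def gradEst (X : Set (Vec d)) (Ft p : Vec d → Z → ℝ) (x : Vec d) (z : Z) : Vec d :=
  grad X (fun y => Ft y z) x + Ft x z • score X p x z

/-- The unbiased one-sample estimate `∇̃²F(x, z)` of `∇²F(x)`:
`F̃ ∇log p (∇log p)ᵀ + ∇F̃ (∇log p)ᵀ + ∇log p (∇F̃)ᵀ + ∇²F̃ + F̃ ∇² log p`. -/
def hessEst (X : Set (Vec d)) (Ft p : Vec d → Z → ℝ) (x : Vec d) (z : Z) :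
    Vec d →L[ℝ] Vec d :=
  Ft x z • outer (score X p x z) (score X p x z)
    + outer (grad X (fun y => Ft y z) x) (score X p x z)
    + outer (score X p x z) (grad X (fun y => Ft y z) x)
    + hess X (fun y => Ft y z) x
    + Ft x z • scoreHess X p x z

/-- The point `x(a) = a y + (1 - a) x`, for `a ∈ [0, 1]`. -/
def between (x y : Vec d) (a : unitInterval) : Vec d :=
  (a : ℝ) • y + (1 - (a : ℝ)) • x

/-- The joint law of one sample `(a, z(a))`: `a` is uniform on `[0, 1]` and, given `a`, the
variable `z(a)` has distribution `p(z; x(a))` with `x(a) = a y + (1 - a) x`. -/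
def sampleLaw (ν : Measure Z) (p : Vec d → Z → ℝ) (x y : Vec d) : Measure (unitInterval × Z) :=
  ((volume : Measure unitInterval).prod ν).withDensity
    (fun s => ENNReal.ofReal (p (between x y s.1) s.2))

/-- The setting: a convex domain `X` with nonempty interior that contains the origin and the
nonempty compact convex constraint set `C`; a stochastic function `F̃` and a family of positive
probability densities `p(z; x)` such that `F̃` and `log p` are twice continuously differentiable
in `x` and they and their derivatives are measurable in `z`. -/
structure Setting (ν : Measure Z) (X C : Set (Vec d)) (Ft p : Vec d → Z → ℝ) : Prop where
  convex_dom : Convex ℝ X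
  interior_dom : (interior X).Nonempty
  zero_mem : (0 : Vec d) ∈ X
  subset_dom : C ⊆ X
  convex_constr : Convex ℝ C
  compact_constr : IsCompact C
  nonempty_constr : C.Nonempty
  density_pos : ∀ x ∈ X, ∀ z, 0 < p x z
  density_one : ∀ x ∈ X, ∫⁻ z, ENNReal.ofReal (p x z) ∂ν = 1
  smooth_fun : ∀ z, ContDiffOn ℝ 2 (fun x => Ft x z) X
  smooth_log : ∀ z, ContDiffOn ℝ 2 (fun x => Real.log (p x z)) X
  meas_fun : ∀ x ∈ X, Measurable (fun z => Ft x z)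
  meas_grad : ∀ x ∈ X, Measurable (fun z => grad X (fun y => Ft y z) x)
  meas_hess : ∀ x ∈ X, Measurable (fun z => hess X (fun y => Ft y z) x)
  meas_density : ∀ x ∈ X, Measurable (fun z => p x z)
  meas_score : ∀ x ∈ X, Measurable (fun z => score X p x z)
  meas_scoreHess : ∀ x ∈ X, Measurable (fun z => scoreHess X p x z)

/-- Bounded diameter: distances in the constraint set, the starting point `0` of the method
included, are at most `D`. -/
def DiameterBound (C : Set (Vec d)) (D : ℝ) : Prop :=
  ∀ x ∈ insert 0 C, ∀ y ∈ insert 0 C, ‖x - y‖ ≤ D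

/-- The stochastic function, its gradient and its Hessian are bounded. -/
structure FunctionBounds (X : Set (Vec d)) (Ft : Vec d → Z → ℝ) (B G LF : ℝ) : Prop where
  value : ∀ x ∈ X, ∀ z, |Ft x z| ≤ B
  gradient : ∀ x ∈ X, ∀ z, ‖grad X (fun y => Ft y z) x‖ ≤ G
  hessian : ∀ x ∈ X, ∀ z, ‖hess X (fun y => Ft y z) x‖ ≤ LF

/-- Moment bounds on the gradient and the Hessian of `log p`: for all `x ∈ X`, with `z`
distributed according to `p(z; x)`, `𝔼 ‖∇ log p‖⁴ ≤ Gp⁴` and `𝔼 ‖∇² log p‖² ≤ Lp²`. -/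
structure DensityBounds (ν : Measure Z) (X : Set (Vec d)) (p : Vec d → Z → ℝ)
    (Gp Lp : ℝ) : Prop where
  gradient : ∀ x ∈ X,
    ∫⁻ z, ENNReal.ofReal (‖score X p x z‖ ^ 4) ∂(law ν p x) ≤ ENNReal.ofReal (Gp ^ 4)
  hessian : ∀ x ∈ X,
    ∫⁻ z, ENNReal.ofReal (‖scoreHess X p x z‖ ^ 2) ∂(law ν p x) ≤ ENNReal.ofReal (Lp ^ 2)

/-- The Hessians of the stochastic function and of `log p` are Lipschitz continuous. -/
structure HessianLipschitz (X : Set (Vec d)) (Ft p : Vec d → Z → ℝ) (L2F L2p : ℝ) : Prop where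
  function : ∀ x ∈ X, ∀ y ∈ X, ∀ z,
    ‖hess X (fun w => Ft w z) x - hess X (fun w => Ft w z) y‖ ≤ L2F * ‖x - y‖
  density : ∀ x ∈ X, ∀ y ∈ X, ∀ z,
    ‖scoreHess X p x z - scoreHess X p y z‖ ≤ L2p * ‖x - y‖

/-- A run of SCG++ with `T` iterations (numbered `0, …, T - 1`), a first minibatch `M₀` of `m₀`
samples and minibatches `M t` of `m t` samples in the iterations `t = 1, …, T - 1`.
`𝓕 t` is the information available after iteration `t`; `x t` are the iterates, `g t` the
gradient estimates and `v t` the ascent directions. -/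
structure IsRun (ν : Measure Z) (X C : Set (Vec d)) (Ft p : Vec d → Z → ℝ)
    (T m₀ : ℕ) (m : ℕ → ℕ) (P : Measure Ω) (𝓕 : Filtration ℕ ‹MeasurableSpace Ω›)
    (M₀ : Fin m₀ → Ω → Z) (M : (t : ℕ) → Fin (m t) → Ω → unitInterval × Z)
    (x g v : ℕ → Ω → Vec d) : Prop where
  /-- the first minibatch is available after iteration `0` -/
  meas_first : ∀ i, Measurable[𝓕 0] (M₀ i)
  /-- the first minibatch consists of independent samples of `p(z; x₀)`, `x₀ = 0` -/
  law_first : P.map (fun ω i => M₀ i ω) = Measure.pi (fun _ : Fin m₀ => law ν p 0)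
  /-- the minibatch of iteration `t` is available after that iteration -/
  meas_batch : ∀ t, 1 ≤ t → t < T → ∀ i, Measurable[𝓕 t] (M t i)
  /-- conditionally on the past, the minibatch of iteration `t + 1` consists of independent
  samples `(a, z(a))`, where `a` is uniform on `[0, 1]`, `z(a) ∼ p(z; x(a))` and
  `x(a) = a x_{t+1} + (1 - a) x_t` -/
  law_batch : ∀ t, t + 1 < T → ∀ A, MeasurableSet[𝓕 t] A →
    ∀ S : Set (Fin (m (t + 1)) → unitInterval × Z), MeasurableSet S →
      P (A ∩ {ω | (fun i => M (t + 1) i ω) ∈ S}) =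
        ∫⁻ ω in A, Measure.pi
          (fun _ : Fin (m (t + 1)) => sampleLaw ν p (x t ω) (x (t + 1) ω)) S ∂P
  /-- the method starts from the origin -/
  start : ∀ ω, x 0 ω = 0
  /-- the first gradient estimate is the minibatch average over `M₀` -/
  est_zero : ∀ ω, g 0 ω = (1 / (m₀ : ℝ)) • ∑ i, gradEst X Ft p (x 0 ω) (M₀ i ω)
  /-- `ĝ_{t+1} = ĝ_t + ∇̃²_{t+1} (x_{t+1} - x_t)`, where `∇̃²_{t+1}` is the minibatch average of
  the Hessian estimates -/
  est_succ : ∀ t, t + 1 < T → ∀ ω,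
    g (t + 1) ω = g t ω +
      ((1 / (m (t + 1) : ℝ)) • ∑ i, hessEst X Ft p
        (between (x t ω) (x (t + 1) ω) (M (t + 1) i ω).1) (M (t + 1) i ω).2)
        (x (t + 1) ω - x t ω)
  /-- `v t` is chosen after iteration `t` has sampled its minibatch, without using later samples -/
  meas_dir : ∀ t, t < T → Measurable[𝓕 t] (v t)
  /-- `v t` maximizes `⟨ĝ_t, ·⟩` over `C` -/
  dir_mem : ∀ t, t < T → ∀ ω, v t ω ∈ C
  dir_max : ∀ t, t < T → ∀ ω, ∀ w ∈ C, inner ℝ (g t ω) w ≤ inner ℝ (g t ω) (v t ω)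
  /-- the update with step size `1 / T` -/
  step : ∀ t, t < T → ∀ ω, x (t + 1) ω = x t ω + (1 / (T : ℝ)) • v t ω

end SCGPlus

end

/-! Let e_t = ∇F(x_t) - ĝ_t. Given the past, each Hessian sample applied to x_{t+1} - x_t is an
unbiased estimate W of ∇F(x_{t+1}) - ∇F(x_t), so e_{t+1} is e_t plus an average of independent
centred terms 𝔼W - W_i. Cross terms vanish, the variance is at most the second moment, and
𝔼‖e_{t+1}‖² ≤ 𝔼‖e_t‖² + L²D²/T², because ‖x_{t+1} - x_t‖ ≤ D/T (`lintegral_sq_error_succ_le`). The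
size of the first batch gives 𝔼‖e_0‖² ≤ L²D². Hence 𝔼‖e_t‖² ≤ L²D²(1 + t/T²) ≤ 2L²D², and the
expected sum of squared errors is at most 2TL²D². The sum on the right of the claim is at least its
term t = 1, namely 2L²D², so Markov's inequality finishes.

Unbiasedness rests on ∇(F̃p) = p·`gradEst` and D(p·`gradEst`) = p·`hessEst`. For fixed z the
fundamental theorem of calculus applies along the segment, and Fubini exchanges the integrals over a
and z (`integral_prod_fderiv_between`, `integral_hessEst_between`). Fubini only needs a bound,
uniform in x, on the integral of the norm of the derivative, and the moment assumptions supply it.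

The same device replaces domination in ∇F = 𝔼 `gradEst` (`grad_objective`): increments of F are
integrals of `meanGrad` along segments, and `meanGrad` is Lipschitz, so it is the gradient. -/

/-! ### Second moments of minibatch averages -/

open ProbabilityTheory in
-- Expand the square. The part linear in c vanishes by centring, the off-diagonal products vanish by
-- independence and centring, and the n diagonal terms carry the weight 1/n².
theorem integral_norm_add_average_sq {S E : Type*} [MeasurableSpace S]
    [NormedAddCommGroup E] [InnerProductSpace ℝ E] [CompleteSpace E] [MeasurableSpace E]
    [BorelSpace E] {μ : Measure S} [IsProbabilityMeasure μ] {Y : S → E} (hY : MemLp Y 2 μ)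
    (hm : Measurable Y) (hmean : ∫ s, Y s ∂μ = 0) (c : E) (n : ℕ) (hn : 1 ≤ n) :
    Integrable (fun s : Fin n → S => ‖c + (1 / (n : ℝ)) • ∑ i, Y (s i)‖ ^ 2)
        (Measure.pi fun _ => μ) ∧
      ∫ s : Fin n → S, ‖c + (1 / (n : ℝ)) • ∑ i, Y (s i)‖ ^ 2 ∂(Measure.pi fun _ => μ)
        = ‖c‖ ^ 2 + (∫ s, ‖Y s‖ ^ 2 ∂μ) / n := by
  set π : Measure (Fin n → S) := Measure.pi fun _ => μ with hπ
  have hL : ∀ i, MemLp (fun s : Fin n → S => Y (s i)) 2 π := fun i =>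
    hY.comp_measurePreserving (measurePreserving_eval (fun _ : Fin n => μ) i)
  have hI : ∀ i, Integrable (fun s : Fin n → S => Y (s i)) π := fun i =>
    (hL i).integrable (by norm_num)
  have hindep : iIndepFun (fun (i : Fin n) (s : Fin n → S) => Y (s i)) π :=
    iIndepFun_pi (fun _ => hm.aemeasurable)
  have hcross : ∀ i j, Integrable (fun s : Fin n → S => inner ℝ (Y (s i)) (Y (s j))) π :=
    fun i j => by
      refine Integrable.mono' (g := fun s => ‖Y (s i)‖ ^ 2 + ‖Y (s j)‖ ^ 2)
        ((hL i).norm.integrable_sq.add (hL j).norm.integrable_sq)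
        ((hI i).1.inner (hI j).1) (Filter.Eventually.of_forall fun s => ?_)
      refine (norm_inner_le_norm _ _).trans ?_
      nlinarith [sq_nonneg (‖Y (s i)‖ - ‖Y (s j)‖), sq_nonneg (‖Y (s i)‖ + ‖Y (s j)‖)]
  have hexp : ∀ s : Fin n → S, ‖c + (1 / (n : ℝ)) • ∑ i, Y (s i)‖ ^ 2 =
      ‖c‖ ^ 2 + (2 / n) * ∑ i, inner ℝ c (Y (s i))
        + (1 / (n : ℝ) ^ 2) * ∑ i, ∑ j, inner ℝ (Y (s i)) (Y (s j)) := by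
    intro s
    rw [norm_add_sq_real, inner_smul_right, inner_sum, norm_smul, mul_pow,
      ← real_inner_self_eq_norm_sq (∑ i, Y (s i)), sum_inner]
    simp only [inner_sum]
    rw [Real.norm_eq_abs, sq_abs]
    ring
  have hci : ∀ i, Integrable (fun s : Fin n → S => inner ℝ c (Y (s i))) π :=
    fun i => (hI i).const_inner c
  have i1 : Integrable (fun s : Fin n → S => (2 / (n : ℝ)) * ∑ i, inner ℝ c (Y (s i))) π :=
    (integrable_finsetSum _ fun i _ => hci i).const_mul _
  have i2 : Integrable (fun s : Fin n → S =>
      (1 / (n : ℝ) ^ 2) * ∑ i, ∑ j, inner ℝ (Y (s i)) (Y (s j))) π :=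
    (integrable_finsetSum _ fun i _ => integrable_finsetSum _ fun j _ => hcross i j).const_mul _
  simp only [hexp]
  have i3 : Integrable (fun s : Fin n → S =>
      ‖c‖ ^ 2 + (2 / (n : ℝ)) * ∑ i, inner ℝ c (Y (s i))) π := (integrable_const _).add i1
  refine ⟨i3.add i2, ?_⟩
  have e1 : ∀ i, ∫ s : Fin n → S, inner ℝ c (Y (s i)) ∂π = 0 := fun i => by
    rw [integral_inner (hI i), integral_comp_eval (i := i) hY.1, hmean, inner_zero_right]
  have e2 : ∀ i j, ∫ s : Fin n → S, inner ℝ (Y (s i)) (Y (s j)) ∂π =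
      if i = j then ∫ s, ‖Y s‖ ^ 2 ∂μ else 0 := fun i j => by
    split_ifs with h
    · subst h
      simp only [real_inner_self_eq_norm_sq]
      exact integral_comp_eval (μ := fun _ : Fin n => μ) (i := i) (f := fun s => ‖Y s‖ ^ 2)
        (hY.1.norm.pow 2)
    · have : ∫ s : Fin n → S, inner ℝ (Y (s i)) (Y (s j)) ∂π =
          inner ℝ (∫ s : Fin n → S, Y (s i) ∂π) (∫ s : Fin n → S, Y (s j) ∂π) :=
        (hindep.indepFun h).integral_bilin (hI i) (hI j) (innerSL ℝ : E →L[ℝ] E →L[ℝ] ℝ)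
      rw [this, integral_comp_eval (i := i) hY.1, hmean, inner_zero_left]
  rw [integral_add i3 i2, integral_add (integrable_const _) i1,
    integral_const_mul, integral_const_mul, integral_finsetSum _ fun i _ => hci i,
    integral_finsetSum _ fun i _ => integrable_finsetSum _ fun j _ => hcross i j]
  simp_rw [integral_finsetSum _ fun j _ => hcross _ j, e1, e2]
  have : (n : ℝ) ≠ 0 := by positivity
  simp
  field_simp

/-- The average of `n` independent copies of `c + 𝔼 W - W` has second moment at most
`‖c‖² + 𝔼 ‖W‖² / n`. -/
theorem lintegral_norm_add_average_sq_le {S E : Type*} [MeasurableSpace S]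
    [NormedAddCommGroup E] [InnerProductSpace ℝ E] [CompleteSpace E] [MeasurableSpace E]
    [BorelSpace E] [SecondCountableTopology E]
    {μ : Measure S} [IsProbabilityMeasure μ] {W : S → E} (hm : Measurable W) {K : ℝ} (hK0 : 0 ≤ K)
    (hK : ∫⁻ s, ENNReal.ofReal (‖W s‖ ^ 2) ∂μ ≤ ENNReal.ofReal K) (c : E) (n : ℕ) (hn : 1 ≤ n) :
    ∫⁻ s : Fin n → S, ENNReal.ofReal (‖c + (1 / (n : ℝ)) • ∑ i, ((∫ r, W r ∂μ) - W (s i))‖ ^ 2)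
        ∂(Measure.pi fun _ => μ) ≤ ENNReal.ofReal (‖c‖ ^ 2 + K / n) := by
  have hint : Integrable (fun s => ‖W s‖ ^ 2) μ := by
    refine ⟨(hm.norm.pow_const 2).aestronglyMeasurable, ?_⟩
    rw [hasFiniteIntegral_iff_ofReal (Filter.Eventually.of_forall fun s => by positivity)]
    exact hK.trans_lt ENNReal.ofReal_lt_top
  have hW : MemLp W 2 μ := (memLp_two_iff_integrable_sq_norm hm.aestronglyMeasurable).2 hint
  have hWi : Integrable W μ := hW.integrable (by norm_num)
  have hKi : ∫ s, ‖W s‖ ^ 2 ∂μ ≤ K := by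
    rw [integral_eq_lintegral_of_nonneg_ae (Filter.Eventually.of_forall fun s => by positivity)
      hint.1]
    exact ENNReal.toReal_le_of_le_ofReal hK0 hK
  set w := ∫ r, W r ∂μ with hw
  have hY : MemLp (fun s => w - W s) 2 μ := (memLp_const w).sub hW
  have hmean : ∫ s, (w - W s) ∂μ = 0 := by
    rw [integral_sub (integrable_const _) hWi]; simp [hw]
  -- 𝔼‖w - W‖² = 𝔼‖W‖² - ‖w‖², since w is the mean.
  have hvar : ∫ s, ‖w - W s‖ ^ 2 ∂μ ≤ K := by
    have : ∀ s, ‖w - W s‖ ^ 2 = ‖w‖ ^ 2 - 2 * inner ℝ w (W s) + ‖W s‖ ^ 2 := fun s =>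
      norm_sub_sq_real _ _
    simp_rw [this]
    have i1 : Integrable (fun s => 2 * inner ℝ w (W s)) μ := (hWi.const_inner w).const_mul 2
    have i2 : Integrable (fun s => ‖w‖ ^ 2 - 2 * inner ℝ w (W s)) μ :=
      (integrable_const _).sub i1
    rw [integral_add i2 hint, integral_sub (integrable_const _) i1,
      integral_const_mul, integral_inner hWi, ← hw, real_inner_self_eq_norm_sq]
    simp
    nlinarith [sq_nonneg ‖w‖]
  obtain ⟨hi, he⟩ := integral_norm_add_average_sq hY (hm.const_sub w) hmean c n hn
  rw [← ofReal_integral_eq_lintegral_ofReal hi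
    (Filter.Eventually.of_forall fun s => by positivity), he]
  gcongr

/-! ### Conditional laws and kernels -/

open ProbabilityTheory in
/-- If `κ (σ ω)` is the conditional law of `M` given `σ`, expectations of functions of `(σ, M)`
are iterated integrals. -/
theorem lintegral_comp_of_condLaw {Ω W Y : Type*} [MeasurableSpace Ω] [MeasurableSpace W]
    [MeasurableSpace Y] (P : Measure Ω) [IsFiniteMeasure P] {σ : Ω → W} {M : Ω → Y}
    (hσ : Measurable σ) (hM : Measurable M) {κ : W → Measure Y}
    (hκ : Measurable κ) [∀ w, IsProbabilityMeasure (κ w)]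
    (h : ∀ A, MeasurableSet A → ∀ S, MeasurableSet S →
      P (σ ⁻¹' A ∩ M ⁻¹' S) = ∫⁻ ω in σ ⁻¹' A, κ (σ ω) S ∂P)
    {Φ : W × Y → ENNReal} (hΦ : Measurable Φ) :
    ∫⁻ ω, Φ (σ ω, M ω) ∂P = ∫⁻ ω, ∫⁻ y, Φ (σ ω, y) ∂κ (σ ω) ∂P := by
  let k : Kernel W Y := ⟨κ, hκ⟩
  have : IsMarkovKernel k := ⟨fun w => inferInstanceAs (IsProbabilityMeasure (κ w))⟩
  -- The hypothesis gives equality on measurable rectangles, which determine a finite measure on the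
  -- product.
  have hmap : P.map (fun ω => (σ ω, M ω)) = (P.map σ).compProd k := by
    have : IsFiniteMeasure (P.map fun ω => (σ ω, M ω)) := inferInstance
    refine Measure.ext_prod fun {A S} hA hS => ?_
    rw [Measure.map_apply (hσ.prodMk hM) (hA.prod hS), Measure.compProd_apply_prod hA hS,
      setLIntegral_map hA (k.measurable_coe hS) hσ]
    exact h A hA S hS
  rw [← lintegral_map hΦ (hσ.prodMk hM), hmap, Measure.lintegral_compProd hΦ,
    lintegral_map (hΦ.lintegral_kernel_prod_right') hσ]
  rfl

/-- Boxes form a π-system generating the product σ-algebra, and the measure of a box is a finite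
product of measurable functions of w. -/
theorem measurable_measure_pi {W S : Type*} [MeasurableSpace W] [MeasurableSpace S] (n : ℕ)
    {μ : W → Measure S} [∀ w, IsProbabilityMeasure (μ w)] (hμ : Measurable μ) :
    Measurable fun w => Measure.pi (fun _ : Fin n => μ w) := by
  refine Measurable.measure_of_isPiSystem_of_isProbabilityMeasure generateFrom_pi.symm
    isPiSystem_pi ?_
  rintro _ ⟨s, hs, rfl⟩
  simp_rw [Measure.pi_pi]
  exact Finset.measurable_prod _ fun i _ =>
    (Measure.measurable_coe (hs i (Set.mem_univ i))).comp hμ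

/-! ### Calculus along segments of a convex domain -/

namespace SCGPlus

theorem between_mem {d : ℕ} {X : Set (Vec d)} (hX : Convex ℝ X) {x y : Vec d} (hx : x ∈ X)
    (hy : y ∈ X) (a : unitInterval) : between x y a ∈ X :=
  hX hy hx a.2.1 (by linarith [a.2.2]) (by ring)

theorem continuous_between {d : ℕ} :
    Continuous fun q : Vec d × Vec d × unitInterval => between q.1 q.2.1 q.2.2 := by
  unfold between; fun_prop

theorem norm_between_sub_le {d : ℕ} (x y : Vec d) (a : unitInterval) :
    ‖between x y a - x‖ ≤ ‖y - x‖ := by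
  have : between x y a - x = (a : ℝ) • (y - x) := by
    unfold between; module
  rw [this, norm_smul, Real.norm_of_nonneg a.2.1]
  exact mul_le_of_le_one_left (norm_nonneg _) a.2.2

/-- The fundamental theorem of calculus on a segment of a convex domain. -/
theorem integral_fderiv_between {d : ℕ} {E : Type*} [NormedAddCommGroup E] [NormedSpace ℝ E]
    [CompleteSpace E] {X : Set (Vec d)} (hX : Convex ℝ X) {f : Vec d → E}
    {f' : Vec d → Vec d →L[ℝ] E} (hf : ∀ x ∈ X, HasFDerivWithinAt f (f' x) X x)
    (hc : ContinuousOn f' X) {x y : Vec d} (hx : x ∈ X) (hy : y ∈ X) :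
    ∫ a : unitInterval, f' (between x y a) (y - x) = f y - f x := by
  set γ : ℝ → Vec d := fun a => a • y + (1 - a) • x with hγ
  have hmem : ∀ a ∈ Set.Icc (0 : ℝ) 1, γ a ∈ X := fun a ha => between_mem hX hx hy ⟨a, ha⟩
  have hγc : Continuous γ := by fun_prop
  have hγd : ∀ a, HasDerivAt γ (y - x) a := fun a => by
    have h1 : HasDerivAt (fun a : ℝ => a • y) ((1 : ℝ) • y) a := (hasDerivAt_id a).smul_const y
    have h2 : HasDerivAt (fun a : ℝ => (1 - a) • x) ((-1 : ℝ) • x) a :=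
      ((hasDerivAt_id a).const_sub 1).smul_const x
    have h3 : (1 : ℝ) • y + (-1 : ℝ) • x = y - x := by module
    exact h3 ▸ h1.add h2
  have hfc : ContinuousOn f X := fun x hx => (hf x hx).continuousWithinAt
  have hint : ∫ a : unitInterval, f' (between x y a) (y - x) =
      ∫ a in Set.Icc (0 : ℝ) 1, f' (γ a) (y - x) :=
    integral_subtype_comap measurableSet_Icc (fun a : ℝ => f' (γ a) (y - x))
  have hcc : ContinuousOn (fun a => f' (γ a) (y - x)) (Set.Icc 0 1) :=
    (hc.comp hγc.continuousOn hmem).clm_apply continuousOn_const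
  rw [hint, integral_Icc_eq_integral_Ioc, ← intervalIntegral.integral_of_le zero_le_one,
    intervalIntegral.integral_eq_sub_of_hasDerivAt_of_le (f := fun a => f (γ a)) zero_le_one
      (hfc.comp hγc.continuousOn hmem)]
  · simp [hγ]
  -- Differentiability within X yields a derivative within [0, 1], which is an ordinary derivative
  -- at interior points.
  · intro a ha
    have ha' := Set.Ioo_subset_Icc_self ha
    exact ((hf _ (hmem a ha')).comp_hasDerivWithinAt a (hγd a).hasDerivWithinAt hmem).hasDerivAt
      (Icc_mem_nhds ha.1 ha.2)
  · exact hcc.intervalIntegrable_of_Icc zero_le_one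

/-- Carathéodory functions on a domain are jointly measurable along measurable selections. -/
theorem measurable_comp_of_continuousOn {d : ℕ} {Z S E : Type*} [MeasurableSpace Z]
    {_ : MeasurableSpace S} [TopologicalSpace E] [TopologicalSpace.PseudoMetrizableSpace E]
    [MeasurableSpace E] [BorelSpace E] {X : Set (Vec d)} {φ : Vec d → Z → E}
    (hc : ∀ z, ContinuousOn (fun x => φ x z) X) (hm : ∀ x ∈ X, Measurable (φ x))
    {ξ : S → Vec d} {ζ : S → Z} (hξ : Measurable ξ) (hmem : ∀ s, ξ s ∈ X) (hζ : Measurable ζ) :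
    Measurable fun s => φ (ξ s) (ζ s) := by
  have h : Measurable (Function.uncurry fun (x : X) z => φ x z) :=
    measurable_uncurry_of_continuous_of_measurable
      (fun z => continuousOn_iff_continuous_domRestrict.1 (hc z)) (fun x => hm x x.2)
  have h2 : Measurable fun s => ((⟨ξ s, hmem s⟩ : X), ζ s) := (hξ.subtype_mk).prodMk hζ
  exact h.comp h2

/-! ### Increments of parametric integrals by Fubini -/

section Fubini

variable {d : ℕ} {Z E : Type*} [MeasurableSpace Z] {ν : Measure Z} [SigmaFinite ν]
  [NormedAddCommGroup E] [NormedSpace ℝ E] [MeasurableSpace E] [BorelSpace E]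
  {X : Set (Vec d)} {φ : Vec d → Z → E}
  {φ' : Vec d → Z → Vec d →L[ℝ] E} {K : ℝ}

/-- Tonelli: integrating over z first, the bound K applies at each point of the segment. -/
theorem lintegral_fderiv_between_le (hX : Convex ℝ X)
    (hc : ∀ z, ContinuousOn (fun x => φ' x z) X) (hm : ∀ x ∈ X, ∀ h, Measurable fun z => φ' x z h)
    (hK : ∀ x ∈ X, ∫⁻ z, ‖φ' x z‖ₑ ∂ν ≤ ENNReal.ofReal K)
    {x y : Vec d} (hx : x ∈ X) (hy : y ∈ X) :
    Measurable (fun s : unitInterval × Z => φ' (between x y s.1) s.2 (y - x)) ∧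
    ∫⁻ s : unitInterval × Z, ‖φ' (between x y s.1) s.2 (y - x)‖ₑ ∂(volume.prod ν) ≤
      ENNReal.ofReal (K * ‖y - x‖) := by
  have hmeas : Measurable (fun s : unitInterval × Z => φ' (between x y s.1) s.2 (y - x)) := by
    refine measurable_comp_of_continuousOn (φ := fun x' z => φ' x' z (y - x))
      (ξ := fun s : unitInterval × Z => between x y s.1) (ζ := Prod.snd)
      (fun z => (hc z).clm_apply continuousOn_const) (fun x' hx' => hm x' hx' _) ?_
      (fun s => between_mem hX hx hy _) measurable_snd
    exact (continuous_between.comp (continuous_const.prodMk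
      (continuous_const.prodMk continuous_id))).measurable.comp measurable_fst
  refine ⟨hmeas, ?_⟩
  rw [lintegral_prod _ hmeas.enorm.aemeasurable]
  calc ∫⁻ a : unitInterval, ∫⁻ z, ‖φ' (between x y a) z (y - x)‖ₑ ∂ν
      ≤ ∫⁻ a : unitInterval, ENNReal.ofReal (K * ‖y - x‖) := by
        refine lintegral_mono fun a => ?_
        calc ∫⁻ z, ‖φ' (between x y a) z (y - x)‖ₑ ∂ν
            ≤ ∫⁻ z, ‖φ' (between x y a) z‖ₑ * ‖y - x‖ₑ ∂ν :=
              lintegral_mono fun z => ContinuousLinearMap.le_opENorm _ _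
          _ = (∫⁻ z, ‖φ' (between x y a) z‖ₑ ∂ν) * ‖y - x‖ₑ :=
              lintegral_mul_const' _ _ enorm_ne_top
          _ ≤ ENNReal.ofReal K * ‖y - x‖ₑ := by
              gcongr; exact hK _ (between_mem hX hx hy a)
          _ = ENNReal.ofReal (K * ‖y - x‖) := by
              rw [← ofReal_norm, ← ENNReal.ofReal_mul' (norm_nonneg _)]
    _ = ENNReal.ofReal (K * ‖y - x‖) := by simp

theorem integrable_fderiv_between [SecondCountableTopology E] (hX : Convex ℝ X)
    (hc : ∀ z, ContinuousOn (fun x => φ' x z) X) (hm : ∀ x ∈ X, ∀ h, Measurable fun z => φ' x z h)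
    (hK : ∀ x ∈ X, ∫⁻ z, ‖φ' x z‖ₑ ∂ν ≤ ENNReal.ofReal K)
    {x y : Vec d} (hx : x ∈ X) (hy : y ∈ X) :
    Integrable (fun s : unitInterval × Z => φ' (between x y s.1) s.2 (y - x))
      (volume.prod ν) := by
  obtain ⟨h1, h2⟩ := lintegral_fderiv_between_le hX hc hm hK hx hy
  exact ⟨h1.aestronglyMeasurable, h2.trans_lt ENNReal.ofReal_lt_top⟩

/-- Differences of `∫ φ x z dν(z)` are integrals of the derivative over the segment and `ν`; no
domination is needed besides a uniform bound on `∫ ‖φ'(x, z)‖ dν(z)`. -/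
theorem integral_prod_fderiv_between [CompleteSpace E] [SecondCountableTopology E]
    (hX : Convex ℝ X)
    (hφ : ∀ z, ∀ x ∈ X, HasFDerivWithinAt (fun x => φ x z) (φ' x z) X x)
    (hc : ∀ z, ContinuousOn (fun x => φ' x z) X) (hm : ∀ x ∈ X, ∀ h, Measurable fun z => φ' x z h)
    (hK : ∀ x ∈ X, ∫⁻ z, ‖φ' x z‖ₑ ∂ν ≤ ENNReal.ofReal K)
    (hint : ∀ x ∈ X, Integrable (φ x) ν) {x y : Vec d} (hx : x ∈ X) (hy : y ∈ X) :
    ∫ s : unitInterval × Z, φ' (between x y s.1) s.2 (y - x) ∂(volume.prod ν) =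
      (∫ z, φ y z ∂ν) - ∫ z, φ x z ∂ν := by
  rw [integral_prod_symm _ (integrable_fderiv_between hX hc hm hK hx hy),
    ← integral_sub (hint y hy) (hint x hx)]
  exact integral_congr_ae (Filter.Eventually.of_forall fun z =>
    integral_fderiv_between hX (hφ z) (hc z) hx hy)

theorem norm_integral_sub_le [CompleteSpace E] [SecondCountableTopology E] (hX : Convex ℝ X)
    (hK0 : 0 ≤ K)
    (hφ : ∀ z, ∀ x ∈ X, HasFDerivWithinAt (fun x => φ x z) (φ' x z) X x)
    (hc : ∀ z, ContinuousOn (fun x => φ' x z) X) (hm : ∀ x ∈ X, ∀ h, Measurable fun z => φ' x z h)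
    (hK : ∀ x ∈ X, ∫⁻ z, ‖φ' x z‖ₑ ∂ν ≤ ENNReal.ofReal K)
    (hint : ∀ x ∈ X, Integrable (φ x) ν) {x y : Vec d} (hx : x ∈ X) (hy : y ∈ X) :
    ‖(∫ z, φ y z ∂ν) - ∫ z, φ x z ∂ν‖ ≤ K * ‖y - x‖ := by
  rw [← integral_prod_fderiv_between hX hφ hc hm hK hint hx hy]
  have h := (enorm_integral_le_lintegral_enorm _).trans
    (lintegral_fderiv_between_le hX hc hm hK hx hy).2
  rwa [← ofReal_norm, ENNReal.ofReal_le_ofReal_iff (by positivity)] at h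

end Fubini

/-- A function whose increments are the integrals of a Lipschitz vector field along segments has
that field as its gradient. -/
theorem hasFDerivWithinAt_of_integral_between {d : ℕ} {X : Set (Vec d)} (hX : Convex ℝ X)
    {F : Vec d → ℝ} {h : Vec d → Vec d} {K : ℝ} (hK0 : 0 ≤ K)
    (hLip : ∀ x ∈ X, ∀ y ∈ X, ‖h y - h x‖ ≤ K * ‖y - x‖)
    (hF : ∀ x ∈ X, ∀ y ∈ X,
      ∫ a : unitInterval, inner ℝ (h (between x y a)) (y - x) = F y - F x)
    {x : Vec d} (hx : x ∈ X) :
    HasFDerivWithinAt F (innerSL ℝ (h x)) X x := by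
  have hcont : ContinuousOn h X := by
    refine (LipschitzOnWith.of_dist_le_mul (K := ⟨K, hK0⟩) fun x hx y hy => ?_).continuousOn
    rw [dist_eq_norm, dist_eq_norm]
    exact hLip y hy x hx
  -- The remainder is the mean over a of ⟨h(x(a)) - h(x), y - x⟩, and ‖x(a) - x‖ ≤ ‖y - x‖.
  have hbound : ∀ y ∈ X, ‖F y - F x - innerSL ℝ (h x) (y - x)‖ ≤ K * ‖y - x‖ ^ 2 := by
    intro y hy
    have hci : Continuous fun a : unitInterval => inner ℝ (h (between x y a)) (y - x) := by
      have : Continuous fun a : unitInterval => h (between x y a) :=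
        hcont.comp_continuous (continuous_between.comp (continuous_const.prodMk
          (continuous_const.prodMk continuous_id))) (fun a => between_mem hX hx hy a)
      exact this.inner continuous_const
    have hi : Integrable (fun a : unitInterval => inner ℝ (h (between x y a)) (y - x)) :=
      hci.integrable_of_hasCompactSupport (HasCompactSupport.of_compactSpace _)
    have hone : ∫ _ : unitInterval, inner ℝ (h x) (y - x) = inner ℝ (h x) (y - x) := by simp
    rw [← hF x hx y hy, innerSL_apply_apply, ← hone, ← integral_sub hi (integrable_const _)]
    have := norm_integral_le_of_norm_le_const (μ := (volume : Measure unitInterval))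
      (f := fun a : unitInterval => inner ℝ (h (between x y a)) (y - x) - inner ℝ (h x) (y - x))
      (C := K * ‖y - x‖ ^ 2) (Filter.Eventually.of_forall fun a => by
        rw [← inner_sub_left]
        refine (norm_inner_le_norm _ _).trans ?_
        have h1 := hLip x hx _ (between_mem hX hx hy a)
        have h2 := norm_between_sub_le x y a
        calc _ ≤ (K * ‖y - x‖) * ‖y - x‖ := by
              gcongr; exact h1.trans (by gcongr)
          _ = _ := by ring)
    simpa using this
  refine HasFDerivWithinAt.of_isLittleO ?_
  refine Asymptotics.IsBigO.trans_isLittleO (g := fun y => ‖y - x‖ ^ 2) ?_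
    ((Asymptotics.isLittleO_pow_sub_sub x one_lt_two).mono nhdsWithin_le_nhds)
  refine Asymptotics.IsBigO.of_bound K ?_
  filter_upwards [self_mem_nhdsWithin] with y hy
  simpa using hbound y hy

/-! ### Gradients and Hessians within a domain -/

section Calculus

variable {d : ℕ} {X : Set (Vec d)} {f : Vec d → ℝ}

theorem hasFDerivWithinAt_grad {x : Vec d} (hf : DifferentiableWithinAt ℝ f X x) :
    HasFDerivWithinAt f (innerSL ℝ (grad X f x)) X x :=
  hf.hasGradientWithinAt.hasFDerivWithinAt

theorem grad_eq_of_hasFDerivWithinAt (hX : UniqueDiffOn ℝ X) {x : Vec d} (hx : x ∈ X) {u : Vec d}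
    (hf : HasFDerivWithinAt f (innerSL ℝ u) X x) : grad X f x = u := by
  rw [grad, gradientWithin, hf.fderivWithin (hX x hx)]
  exact (InnerProductSpace.toDual ℝ (Vec d)).symm_apply_apply u

theorem contDiffOn_grad (hX : UniqueDiffOn ℝ X) (hf : ContDiffOn ℝ 2 f X) :
    ContDiffOn ℝ 1 (fun x => grad X f x) X :=
  (InnerProductSpace.toDual ℝ (Vec d)).symm.contDiff.comp_contDiffOn
    (hf.fderivWithin hX (by norm_num))

theorem hasFDerivWithinAt_hess (hX : UniqueDiffOn ℝ X) (hf : ContDiffOn ℝ 2 f X) {x : Vec d}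
    (hx : x ∈ X) : HasFDerivWithinAt (fun y => grad X f y) (hess X f x) X x :=
  ((contDiffOn_grad hX hf).differentiableOn one_ne_zero x hx).hasFDerivWithinAt

theorem continuousOn_hess (hX : UniqueDiffOn ℝ X) (hf : ContDiffOn ℝ 2 f X) :
    ContinuousOn (fun x => hess X f x) X :=
  (contDiffOn_grad hX hf).continuousOn_fderivWithin hX le_rfl

theorem outer_apply (u w h : Vec d) : outer u w h = inner ℝ w h • u := rfl

theorem continuous_outer : Continuous fun q : Vec d × Vec d => outer q.1 q.2 := by
  have : (fun q : Vec d × Vec d => outer q.1 q.2) = fun q =>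
      ContinuousLinearMap.smulRightL ℝ (Vec d) (Vec d) (innerSL ℝ q.2) q.1 := rfl
  rw [this]
  fun_prop

theorem norm_outer (u w : Vec d) : ‖outer u w‖ = ‖u‖ * ‖w‖ := by
  rw [outer, ContinuousLinearMap.norm_smulRight_apply, innerSL_apply_norm, mul_comm]

end Calculus

/-! ### Pointwise bounds, derivatives and regularity of the estimators -/

section Model

variable {d : ℕ} {Z : Type*} {X : Set (Vec d)}
  {Ft p : Vec d → Z → ℝ}

theorem norm_gradEst_le {x : Vec d} {z : Z} {B G : ℝ} (hF : |Ft x z| ≤ B)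
    (hG : ‖grad X (fun y => Ft y z) x‖ ≤ G) :
    ‖gradEst X Ft p x z‖ ≤ G + B * ‖score X p x z‖ := by
  unfold gradEst
  refine (norm_add_le _ _).trans ?_
  rw [norm_smul, Real.norm_eq_abs]
  gcongr

theorem norm_hessEst_le {x : Vec d} {z : Z} {B G LF : ℝ} (hF : |Ft x z| ≤ B)
    (hG : ‖grad X (fun y => Ft y z) x‖ ≤ G) (hH : ‖hess X (fun y => Ft y z) x‖ ≤ LF) :
    ‖hessEst X Ft p x z‖ ≤ B * ‖score X p x z‖ ^ 2 + 2 * G * ‖score X p x z‖ + LF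
      + B * ‖scoreHess X p x z‖ := by
  unfold hessEst
  have h1 : ‖Ft x z • outer (score X p x z) (score X p x z)‖ ≤ B * ‖score X p x z‖ ^ 2 := by
    rw [norm_smul, norm_outer, Real.norm_eq_abs, pow_two]; gcongr
  have h2 : ‖outer (grad X (fun y => Ft y z) x) (score X p x z)‖ ≤ G * ‖score X p x z‖ := by
    rw [norm_outer]; gcongr
  have h3 : ‖outer (score X p x z) (grad X (fun y => Ft y z) x)‖ ≤ G * ‖score X p x z‖ := by
    rw [norm_outer, mul_comm]; gcongr
  have h4 : ‖Ft x z • scoreHess X p x z‖ ≤ B * ‖scoreHess X p x z‖ := by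
    rw [norm_smul, Real.norm_eq_abs]; gcongr
  have := norm_add₄_le (a := Ft x z • outer (score X p x z) (score X p x z))
    (b := outer (grad X (fun y => Ft y z) x) (score X p x z))
    (c := outer (score X p x z) (grad X (fun y => Ft y z) x))
    (d := hess X (fun y => Ft y z) x)
  refine (norm_add_le _ _).trans ?_
  linarith

/-- Cauchy–Schwarz for four terms costs the factor 4; the two mixed outer products together count as
2G‖∇log p‖, whence 16 = 4 · 2². -/
theorem sq_norm_hessEst_le {x : Vec d} {z : Z} {B G LF : ℝ} (hF : |Ft x z| ≤ B)
    (hG : ‖grad X (fun y => Ft y z) x‖ ≤ G) (hH : ‖hess X (fun y => Ft y z) x‖ ≤ LF) :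
    ‖hessEst X Ft p x z‖ ^ 2 ≤ 4 * B ^ 2 * ‖score X p x z‖ ^ 4
      + 16 * G ^ 2 * ‖score X p x z‖ ^ 2 + 4 * LF ^ 2 + 4 * B ^ 2 * ‖scoreHess X p x z‖ ^ 2 := by
  have h := norm_hessEst_le (p := p) hF hG hH
  set s := ‖score X p x z‖
  set k := ‖scoreHess X p x z‖
  have h4 : ∀ a b c e : ℝ, (a + b + c + e) ^ 2 ≤ 4 * (a ^ 2 + b ^ 2 + c ^ 2 + e ^ 2) :=
    fun a b c e => by
      nlinarith [sq_nonneg (a - b), sq_nonneg (a - c), sq_nonneg (a - e), sq_nonneg (b - c),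
        sq_nonneg (b - e), sq_nonneg (c - e)]
  calc _ ≤ (B * s ^ 2 + 2 * G * s + LF + B * k) ^ 2 := by gcongr
    _ ≤ _ := h4 _ _ _ _
    _ = _ := by ring

namespace Setting

variable [MeasurableSpace Z] {ν : Measure Z} {C : Set (Vec d)}

theorem uniqueDiffOn (S : Setting ν X C Ft p)
    : UniqueDiffOn ℝ X := uniqueDiffOn_convex S.convex_dom S.interior_dom

theorem hasFDerivWithinAt_fun (S : Setting ν X C Ft p) (z : Z) {x : Vec d} (hx : x ∈ X) :
    HasFDerivWithinAt (fun y => Ft y z) (innerSL ℝ (grad X (fun y => Ft y z) x)) X x :=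
  hasFDerivWithinAt_grad ((S.smooth_fun z).differentiableOn two_ne_zero x hx)

/-- Smoothness is assumed of log p only, so p is differentiated as exp(log p), which gives ∇p = p
∇log p. -/
theorem hasFDerivWithinAt_density (S : Setting ν X C Ft p) (z : Z) {x : Vec d} (hx : x ∈ X) :
    HasFDerivWithinAt (fun y => p y z) (p x z • innerSL ℝ (score X p x z)) X x := by
  have h := (hasFDerivWithinAt_grad ((S.smooth_log z).differentiableOn two_ne_zero x hx)).exp
  rw [Real.exp_log (S.density_pos x hx z)] at h
  exact h.congr (fun y hy => (Real.exp_log (S.density_pos y hy z)).symm)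
    (Real.exp_log (S.density_pos x hx z)).symm

theorem hasFDerivWithinAt_fun_mul_density (S : Setting ν X C Ft p)
    (z : Z) {x : Vec d} (hx : x ∈ X) :
    HasFDerivWithinAt (fun y => Ft y z * p y z) (innerSL ℝ (p x z • gradEst X Ft p x z)) X x := by
  refine ((S.hasFDerivWithinAt_fun z hx).mul (S.hasFDerivWithinAt_density z hx)).congr_fderiv ?_
  ext h
  simp [gradEst]
  ring

/-- As p·`gradEst` is the gradient of F̃p, this is the second derivative of F̃p; the product rule
together with ∇p = p ∇log p produces the five terms of `hessEst`. -/
theorem hasFDerivWithinAt_density_smul_gradEst (S : Setting ν X C Ft p)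
    (z : Z) {x : Vec d} (hx : x ∈ X) :
    HasFDerivWithinAt (fun y => p y z • gradEst X Ft p y z) (p x z • hessEst X Ft p x z) X x := by
  have hs : HasFDerivWithinAt (fun y => score X p y z) (scoreHess X p x z) X x :=
    hasFDerivWithinAt_hess S.uniqueDiffOn (S.smooth_log z) hx
  have h := (S.hasFDerivWithinAt_density z hx).smul
    ((hasFDerivWithinAt_hess S.uniqueDiffOn (S.smooth_fun z) hx).add
      ((S.hasFDerivWithinAt_fun z hx).smul hs))
  refine h.congr_fderiv ?_
  ext1 h
  simp only [hessEst, add_apply, smul_apply, outer_apply,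
    ContinuousLinearMap.smulRight_apply, innerSL_apply_apply,
    Pi.add_apply, Pi.smul_apply']
  module

theorem continuousOn_density (S : Setting ν X C Ft p) (z : Z) : ContinuousOn (fun x => p x z) X :=
  fun _ hx => (S.hasFDerivWithinAt_density z hx).continuousWithinAt

theorem continuousOn_fun (S : Setting ν X C Ft p) (z : Z) : ContinuousOn (fun x => Ft x z) X :=
  (S.smooth_fun z).continuousOn

theorem continuousOn_grad (S : Setting ν X C Ft p)
    (z : Z) : ContinuousOn (fun x => grad X (fun y => Ft y z) x) X :=
  (contDiffOn_grad S.uniqueDiffOn (S.smooth_fun z)).continuousOn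

theorem continuousOn_score (S : Setting ν X C Ft p)
    (z : Z) : ContinuousOn (fun x => score X p x z) X :=
  (contDiffOn_grad S.uniqueDiffOn (S.smooth_log z)).continuousOn

theorem continuousOn_gradEst (S : Setting ν X C Ft p)
    (z : Z) : ContinuousOn (fun x => gradEst X Ft p x z) X :=
  (S.continuousOn_grad z).add ((S.continuousOn_fun z).smul (S.continuousOn_score z))

theorem continuousOn_hessEst (S : Setting ν X C Ft p)
    (z : Z) : ContinuousOn (fun x => hessEst X Ft p x z) X := by
  have hs := S.continuousOn_score z
  have hg := S.continuousOn_grad z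
  have hF := S.continuousOn_fun z
  have h2 : ContinuousOn (fun x => scoreHess X p x z) X :=
    continuousOn_hess S.uniqueDiffOn (S.smooth_log z)
  exact ((((hF.smul (continuous_outer.comp_continuousOn (hs.prodMk hs))).add
    (continuous_outer.comp_continuousOn (hg.prodMk hs))).add
    (continuous_outer.comp_continuousOn (hs.prodMk hg))).add
    (continuousOn_hess S.uniqueDiffOn (S.smooth_fun z))).add (hF.smul h2)

theorem measurable_gradEst (S : Setting ν X C Ft p)
    {x : Vec d} (hx : x ∈ X) : Measurable (gradEst X Ft p x) :=
  (S.meas_grad x hx).add ((S.meas_fun x hx).smul (S.meas_score x hx))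

theorem measurable_hessEst (S : Setting ν X C Ft p)
    {x : Vec d} (hx : x ∈ X) : Measurable (hessEst X Ft p x) := by
  have hs := S.meas_score x hx
  have hg := S.meas_grad x hx
  have hF := S.meas_fun x hx
  exact ((((hF.smul (continuous_outer.measurable.comp (hs.prodMk hs))).add
    (continuous_outer.measurable.comp (hg.prodMk hs))).add
    (continuous_outer.measurable.comp (hs.prodMk hg))).add
    (S.meas_hess x hx)).add (hF.smul (S.meas_scoreHess x hx))

end Setting

end Model

/-! ### Moment bounds for the estimators -/

/-- From r ≤ 1 + r². The value is crude, but it only serves integrability and a qualitative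
Lipschitz bound and does not enter the final constants. -/
theorem lintegral_enorm_le_of_sq {S E : Type*} [MeasurableSpace S] [NormedAddCommGroup E]
    {μ : Measure S} [IsProbabilityMeasure μ] {f : S → E} {K : ℝ} (hK0 : 0 ≤ K)
    (hK : ∫⁻ s, ENNReal.ofReal (‖f s‖ ^ 2) ∂μ ≤ ENNReal.ofReal K) :
    ∫⁻ s, ‖f s‖ₑ ∂μ ≤ ENNReal.ofReal (1 + K) := by
  calc ∫⁻ s, ‖f s‖ₑ ∂μ ≤ ∫⁻ s, (1 + ENNReal.ofReal (‖f s‖ ^ 2)) ∂μ := by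
        refine lintegral_mono fun s => ?_
        rw [← ofReal_norm, ← ENNReal.ofReal_one, ← ENNReal.ofReal_add zero_le_one (by positivity)]
        exact ENNReal.ofReal_le_ofReal (by nlinarith [sq_nonneg (‖f s‖ - 1)])
    _ = 1 + ∫⁻ s, ENNReal.ofReal (‖f s‖ ^ 2) ∂μ := by
        rw [lintegral_add_left measurable_const]; simp
    _ ≤ _ := by
        rw [ENNReal.ofReal_add zero_le_one hK0, ENNReal.ofReal_one]; gcongr

theorem integrable_and_integral_le_of_lintegral {S : Type*} [MeasurableSpace S] {μ : Measure S}
    {f : S → ℝ} (hf : Measurable f) (h0 : ∀ s, 0 ≤ f s) {K : ℝ} (hK0 : 0 ≤ K)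
    (hK : ∫⁻ s, ENNReal.ofReal (f s) ∂μ ≤ ENNReal.ofReal K) :
    Integrable f μ ∧ ∫ s, f s ∂μ ≤ K := by
  have h0' := Filter.Eventually.of_forall (f := ae μ) h0
  constructor
  · refine ⟨hf.aestronglyMeasurable, ?_⟩
    rw [hasFiniteIntegral_iff_ofReal h0']
    exact hK.trans_lt ENNReal.ofReal_lt_top
  · rw [integral_eq_lintegral_of_nonneg_ae h0' hf.aestronglyMeasurable]
    exact ENNReal.toReal_le_of_le_ofReal hK0 hK

/-- Nonnegativity of the variance, (𝔼g)² ≤ 𝔼g², is used for g = f² and then for g = f. -/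
theorem integral_sq_le_of_pow_four {S : Type*} [MeasurableSpace S] {μ : Measure S}
    [IsProbabilityMeasure μ] {f : S → ℝ} (hf : Measurable f) {K : ℝ}
    (hK0 : 0 ≤ K) (hK : ∫⁻ s, ENNReal.ofReal (f s ^ 4) ∂μ ≤ ENNReal.ofReal (K ^ 4)) :
    Integrable f μ ∧ ∫ s, f s ∂μ ≤ K ∧ Integrable (fun s => f s ^ 2) μ ∧
      ∫ s, f s ^ 2 ∂μ ≤ K ^ 2 ∧ Integrable (fun s => f s ^ 4) μ ∧ ∫ s, f s ^ 4 ∂μ ≤ K ^ 4 := by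
  obtain ⟨h4, h4'⟩ := integrable_and_integral_le_of_lintegral (hf.pow_const 4)
    (fun s => by positivity) (by positivity) hK
  have key : ∀ {g : S → ℝ}, Measurable g → Integrable (fun s => g s ^ 2) μ →
      Integrable g μ ∧ (∫ s, g s ∂μ) ^ 2 ≤ ∫ s, g s ^ 2 ∂μ := fun {g} hg h => by
    have hL : MemLp g 2 μ := (memLp_two_iff_integrable_sq hg.aestronglyMeasurable).2 h
    refine ⟨hL.integrable (by norm_num), ?_⟩
    have h1 := ProbabilityTheory.variance_nonneg g μ
    rw [ProbabilityTheory.variance_eq_sub hL] at h1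
    simpa using h1
  have e4 : ∀ s, (f s ^ 2) ^ 2 = f s ^ 4 := fun s => by ring
  obtain ⟨i2, j2⟩ := key (hf.pow_const 2) (by simpa only [e4] using h4)
  obtain ⟨i1, j1⟩ := key hf i2
  simp only [e4] at j2
  have k2 : ∫ s, f s ^ 2 ∂μ ≤ K ^ 2 :=
    le_of_sq_le_sq (by nlinarith [j2.trans h4']) (by positivity)
  exact ⟨i1, le_of_sq_le_sq (j1.trans k2) hK0, i2, k2, h4, h4'⟩

namespace Setting

variable {d : ℕ} {Z : Type*} [MeasurableSpace Z] {ν : Measure Z} {X C : Set (Vec d)}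
  {Ft p : Vec d → Z → ℝ} {B G LF Gp Lp L : ℝ}

theorem isProbabilityMeasure_law (S : Setting ν X C Ft p) {x : Vec d} (hx : x ∈ X) :
    IsProbabilityMeasure (law ν p x) :=
  ⟨by rw [law, withDensity_apply _ MeasurableSet.univ]; simpa using S.density_one x hx⟩

theorem lintegral_law (S : Setting ν X C Ft p) {x : Vec d} (hx : x ∈ X) {f : Z → ENNReal}
    (hf : Measurable f) :
    ∫⁻ z, f z ∂(law ν p x) = ∫⁻ z, ENNReal.ofReal (p x z) * f z ∂ν :=
  lintegral_withDensity_eq_lintegral_mul _ (S.meas_density x hx).ennreal_ofReal hf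

theorem integral_law {E : Type*} [NormedAddCommGroup E] [NormedSpace ℝ E]
    (S : Setting ν X C Ft p) {x : Vec d} (hx : x ∈ X) (f : Z → E) :
    ∫ z, f z ∂(law ν p x) = ∫ z, p x z • f z ∂ν := by
  rw [law, integral_withDensity_eq_integral_toReal_smul (S.meas_density x hx).ennreal_ofReal
    (Filter.Eventually.of_forall fun _ => ENNReal.ofReal_lt_top)]
  simp_rw [ENNReal.toReal_ofReal (S.density_pos x hx _).le]

theorem lintegral_enorm_density_smul {E : Type*} [NormedAddCommGroup E] [NormedSpace ℝ E]
    [MeasurableSpace E] [BorelSpace E] (S : Setting ν X C Ft p) {x : Vec d} (hx : x ∈ X)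
    {f : Z → E} (hf : Measurable f) :
    ∫⁻ z, ‖p x z • f z‖ₑ ∂ν = ∫⁻ z, ‖f z‖ₑ ∂(law ν p x) := by
  rw [S.lintegral_law hx hf.enorm]
  refine lintegral_congr fun z => ?_
  rw [enorm_smul, Real.enorm_of_nonneg (S.density_pos x hx z).le]

theorem nonempty (S : Setting ν X C Ft p) : Nonempty Z := by
  have := S.isProbabilityMeasure_law S.zero_mem
  exact (law ν p 0).nonempty_of_neZero

theorem score_moments (S : Setting ν X C Ft p) (hGp : 0 ≤ Gp) (h : DensityBounds ν X p Gp Lp)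
    {x : Vec d} (hx : x ∈ X) :
    Integrable (fun z => ‖score X p x z‖) (law ν p x) ∧
      ∫ z, ‖score X p x z‖ ∂(law ν p x) ≤ Gp ∧
      Integrable (fun z => ‖score X p x z‖ ^ 2) (law ν p x) ∧
      ∫ z, ‖score X p x z‖ ^ 2 ∂(law ν p x) ≤ Gp ^ 2 ∧
      Integrable (fun z => ‖score X p x z‖ ^ 4) (law ν p x) ∧
      ∫ z, ‖score X p x z‖ ^ 4 ∂(law ν p x) ≤ Gp ^ 4 := by
  have := S.isProbabilityMeasure_law hx
  exact integral_sq_le_of_pow_four (S.meas_score x hx).norm hGp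
    (h.gradient x hx)

/-- The square (G + B‖∇log p‖)² is expanded before integration, so the first two moments recombine
into (G + B Gp)² without loss. -/
theorem lintegral_sq_gradEst_le (S : Setting ν X C Ft p) (hGp : 0 ≤ Gp)
    (hF : FunctionBounds X Ft B G LF) (h : DensityBounds ν X p Gp Lp) {x : Vec d} (hx : x ∈ X) :
    ∫⁻ z, ENNReal.ofReal (‖gradEst X Ft p x z‖ ^ 2) ∂(law ν p x) ≤
      ENNReal.ofReal ((G + B * Gp) ^ 2) := by
  have := S.isProbabilityMeasure_law hx
  obtain ⟨z₀⟩ := S.nonempty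
  have hB : 0 ≤ B := (abs_nonneg _).trans (hF.value x hx z₀)
  have hG : 0 ≤ G := (norm_nonneg _).trans (hF.gradient x hx z₀)
  obtain ⟨i1, b1, i2, b2, -⟩ := S.score_moments hGp h hx
  set s := fun z => ‖score X p x z‖
  have j1 : Integrable (fun z => 2 * G * B * s z) (law ν p x) := i1.const_mul _
  have j2 : Integrable (fun z => B ^ 2 * s z ^ 2) (law ν p x) := i2.const_mul _
  have j3 : Integrable (fun z => G ^ 2 + 2 * G * B * s z) (law ν p x) :=
    (integrable_const _).add j1
  have j4 : Integrable (fun z => G ^ 2 + 2 * G * B * s z + B ^ 2 * s z ^ 2) (law ν p x) :=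
    j3.add j2
  have hs : ∀ z, 0 ≤ s z := fun z => norm_nonneg _
  calc ∫⁻ z, ENNReal.ofReal (‖gradEst X Ft p x z‖ ^ 2) ∂(law ν p x)
      ≤ ∫⁻ z, ENNReal.ofReal (G ^ 2 + 2 * G * B * s z + B ^ 2 * s z ^ 2) ∂(law ν p x) := by
        refine lintegral_mono fun z => ENNReal.ofReal_le_ofReal ?_
        calc _ ≤ (G + B * s z) ^ 2 := by
              gcongr; exact norm_gradEst_le (hF.value x hx z) (hF.gradient x hx z)
          _ = _ := by ring
    _ = ENNReal.ofReal (∫ z, G ^ 2 + 2 * G * B * s z + B ^ 2 * s z ^ 2 ∂(law ν p x)) :=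
        (ofReal_integral_eq_lintegral_ofReal j4 (Filter.Eventually.of_forall fun z => by
          have := hs z; positivity)).symm
    _ ≤ _ := by
        refine ENNReal.ofReal_le_ofReal ?_
        rw [integral_add j3 j2, integral_add (integrable_const _) j1, integral_const_mul,
          integral_const_mul]
        simp only [integral_const, probReal_univ, one_smul]
        calc _ ≤ G ^ 2 + 2 * G * B * Gp + B ^ 2 * Gp ^ 2 := by gcongr
          _ = _ := by ring

/-- The condition on L is the pointwise bound `sq_norm_hessEst_le` with each moment replaced by its
upper bound. -/
theorem lintegral_sq_hessEst_le (S : Setting ν X C Ft p) (hGp : 0 ≤ Gp)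
    (hF : FunctionBounds X Ft B G LF) (h : DensityBounds ν X p Gp Lp)
    (hL : 4 * B ^ 2 * Gp ^ 4 + 16 * G ^ 2 * Gp ^ 2 + 4 * LF ^ 2 + 4 * B ^ 2 * Lp ^ 2 ≤ L ^ 2)
    {x : Vec d} (hx : x ∈ X) :
    ∫⁻ z, ENNReal.ofReal (‖hessEst X Ft p x z‖ ^ 2) ∂(law ν p x) ≤ ENNReal.ofReal (L ^ 2) := by
  have := S.isProbabilityMeasure_law hx
  obtain ⟨-, -, i2, b2, i4, b4⟩ := S.score_moments hGp h hx
  obtain ⟨ih, bh⟩ := integrable_and_integral_le_of_lintegral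
    ((S.meas_scoreHess x hx).norm.pow_const 2) (fun z => by positivity) (by positivity)
    (h.hessian x hx)
  set s := fun z => ‖score X p x z‖
  set k := fun z => ‖scoreHess X p x z‖
  have j1 : Integrable (fun z => 4 * B ^ 2 * s z ^ 4) (law ν p x) := i4.const_mul _
  have j2 : Integrable (fun z => 16 * G ^ 2 * s z ^ 2) (law ν p x) := i2.const_mul _
  have j3 : Integrable (fun z => 4 * B ^ 2 * k z ^ 2) (law ν p x) := ih.const_mul _
  have j4 : Integrable (fun z => 4 * B ^ 2 * s z ^ 4 + 16 * G ^ 2 * s z ^ 2) (law ν p x) :=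
    j1.add j2
  have j5 : Integrable (fun z => 4 * B ^ 2 * s z ^ 4 + 16 * G ^ 2 * s z ^ 2 + 4 * LF ^ 2)
    (law ν p x) := j4.add (integrable_const _)
  have j6 : Integrable (fun z => 4 * B ^ 2 * s z ^ 4 + 16 * G ^ 2 * s z ^ 2 + 4 * LF ^ 2
    + 4 * B ^ 2 * k z ^ 2) (law ν p x) := j5.add j3
  calc ∫⁻ z, ENNReal.ofReal (‖hessEst X Ft p x z‖ ^ 2) ∂(law ν p x)
      ≤ ∫⁻ z, ENNReal.ofReal (4 * B ^ 2 * s z ^ 4 + 16 * G ^ 2 * s z ^ 2 + 4 * LF ^ 2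
          + 4 * B ^ 2 * k z ^ 2) ∂(law ν p x) :=
        lintegral_mono fun z => ENNReal.ofReal_le_ofReal
          (sq_norm_hessEst_le (hF.value x hx z) (hF.gradient x hx z) (hF.hessian x hx z))
    _ = ENNReal.ofReal (∫ z, 4 * B ^ 2 * s z ^ 4 + 16 * G ^ 2 * s z ^ 2 + 4 * LF ^ 2
          + 4 * B ^ 2 * k z ^ 2 ∂(law ν p x)) :=
        (ofReal_integral_eq_lintegral_ofReal j6 (Filter.Eventually.of_forall fun z => by
          positivity)).symm
    _ ≤ _ := by
        refine ENNReal.ofReal_le_ofReal (le_trans ?_ hL)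
        rw [integral_add j5 j3, integral_add j4 (integrable_const _), integral_add j1 j2]
        simp only [integral_const_mul, integral_const, probReal_univ, one_smul]
        gcongr

end Setting

/-! ### The mean gradient and differentiation under the expectation -/

/-- The expectation of the one-sample gradient estimate. -/
noncomputable def meanGrad {d : ℕ} {Z : Type*} [MeasurableSpace Z] (ν : Measure Z) (X : Set (Vec d))
    (Ft p : Vec d → Z → ℝ) (x : Vec d) : Vec d :=
  ∫ z, gradEst X Ft p x z ∂(law ν p x)

namespace Setting

variable {d : ℕ} {Z : Type*} [MeasurableSpace Z] {ν : Measure Z} {X C : Set (Vec d)}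
  {Ft p : Vec d → Z → ℝ} {B G LF Gp Lp L : ℝ}

theorem lintegral_density_smul_gradEst_le (S : Setting ν X C Ft p) (hGp : 0 ≤ Gp)
    (hF : FunctionBounds X Ft B G LF) (h : DensityBounds ν X p Gp Lp) {x : Vec d} (hx : x ∈ X) :
    ∫⁻ z, ‖p x z • gradEst X Ft p x z‖ₑ ∂ν ≤ ENNReal.ofReal (1 + (G + B * Gp) ^ 2) := by
  have := S.isProbabilityMeasure_law hx
  rw [S.lintegral_enorm_density_smul hx (S.measurable_gradEst hx)]
  exact lintegral_enorm_le_of_sq (by positivity) (S.lintegral_sq_gradEst_le hGp hF h hx)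

theorem lintegral_density_smul_hessEst_le (S : Setting ν X C Ft p) (hGp : 0 ≤ Gp)
    (hF : FunctionBounds X Ft B G LF) (h : DensityBounds ν X p Gp Lp)
    (hL : 4 * B ^ 2 * Gp ^ 4 + 16 * G ^ 2 * Gp ^ 2 + 4 * LF ^ 2 + 4 * B ^ 2 * Lp ^ 2 ≤ L ^ 2)
    {x : Vec d} (hx : x ∈ X) :
    ∫⁻ z, ‖p x z • hessEst X Ft p x z‖ₑ ∂ν ≤ ENNReal.ofReal (1 + L ^ 2) := by
  have := S.isProbabilityMeasure_law hx
  rw [S.lintegral_enorm_density_smul hx (S.measurable_hessEst hx)]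
  exact lintegral_enorm_le_of_sq (by positivity) (S.lintegral_sq_hessEst_le hGp hF h hL hx)

theorem integrable_density_smul_gradEst (S : Setting ν X C Ft p) (hGp : 0 ≤ Gp)
    (hF : FunctionBounds X Ft B G LF) (h : DensityBounds ν X p Gp Lp) {x : Vec d} (hx : x ∈ X) :
    Integrable (fun z => p x z • gradEst X Ft p x z) ν :=
  ⟨((S.meas_density x hx).smul (S.measurable_gradEst hx)).aestronglyMeasurable,
    (S.lintegral_density_smul_gradEst_le hGp hF h hx).trans_lt ENNReal.ofReal_lt_top⟩

theorem integrable_fun_mul_density (S : Setting ν X C Ft p)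
    (hF : FunctionBounds X Ft B G LF) {x : Vec d} (hx : x ∈ X) :
    Integrable (fun z => Ft x z * p x z) ν := by
  have hp : Integrable (p x) ν := by
    refine ⟨(S.meas_density x hx).aestronglyMeasurable, ?_⟩
    rw [hasFiniteIntegral_iff_ofReal
      (Filter.Eventually.of_forall fun z => (S.density_pos x hx z).le), S.density_one x hx]
    exact ENNReal.one_lt_top
  exact hp.bdd_mul (c := B) (S.meas_fun x hx).aestronglyMeasurable
    (Filter.Eventually.of_forall fun z => hF.value x hx z)

/-- The mean gradient integrates p·`gradEst`, whose derivative is p·`hessEst`; the uniform bound on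
the integral of its norm is a Lipschitz constant. This precedes any knowledge that F is
differentiable. -/
theorem norm_meanGrad_sub_le [SigmaFinite ν] (S : Setting ν X C Ft p) (hGp : 0 ≤ Gp)
    (hF : FunctionBounds X Ft B G LF) (h : DensityBounds ν X p Gp Lp)
    (hL : 4 * B ^ 2 * Gp ^ 4 + 16 * G ^ 2 * Gp ^ 2 + 4 * LF ^ 2 + 4 * B ^ 2 * Lp ^ 2 ≤ L ^ 2)
    {x y : Vec d} (hx : x ∈ X) (hy : y ∈ X) :
    ‖meanGrad ν X Ft p y - meanGrad ν X Ft p x‖ ≤ (1 + L ^ 2) * ‖y - x‖ := by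
  rw [meanGrad, meanGrad, S.integral_law hy, S.integral_law hx]
  exact norm_integral_sub_le S.convex_dom (by positivity)
    (fun z x hx => S.hasFDerivWithinAt_density_smul_gradEst z hx)
    (fun z => (S.continuousOn_density z).smul (S.continuousOn_hessEst z))
    (fun x hx u => (ContinuousLinearMap.apply ℝ (Vec d) u).continuous.measurable.comp
      ((S.meas_density x hx).smul (S.measurable_hessEst hx)))
    (fun x hx => S.lintegral_density_smul_hessEst_le hGp hF h hL hx)
    (fun x hx => S.integrable_density_smul_gradEst hGp hF h hx) hx hy

/-- Differentiation under the expectation: `∇F(x) = 𝔼 (∇F̃ + F̃ ∇log p)`. -/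
theorem grad_objective [SigmaFinite ν] (S : Setting ν X C Ft p) (hGp : 0 ≤ Gp)
    (hF : FunctionBounds X Ft B G LF) (h : DensityBounds ν X p Gp Lp) {x : Vec d} (hx : x ∈ X) :
    grad X (objective ν Ft p) x = meanGrad ν X Ft p x := by
  have hobj : ∀ y ∈ X, objective ν Ft p y = ∫ z, Ft y z * p y z ∂ν := fun y hy => by
    rw [objective, S.integral_law hy]
    simp_rw [smul_eq_mul, mul_comm]
  -- Any L will do, as only some Lipschitz constant is needed; the square root of the left side is a
  -- witness.
  obtain ⟨L, hL⟩ : ∃ L : ℝ,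
      4 * B ^ 2 * Gp ^ 4 + 16 * G ^ 2 * Gp ^ 2 + 4 * LF ^ 2 + 4 * B ^ 2 * Lp ^ 2 ≤ L ^ 2 :=
    ⟨_, (Real.sq_sqrt (by positivity)).ge⟩
  have hc : ∀ z, ContinuousOn (fun x => innerSL ℝ (p x z • gradEst X Ft p x z)) X := fun z =>
    (innerSL ℝ : Vec d →L[ℝ] Vec d →L[ℝ] ℝ).continuous.comp_continuousOn
      ((S.continuousOn_density z).smul (S.continuousOn_gradEst z))
  have hm : ∀ x ∈ X, ∀ u, Measurable fun z => innerSL ℝ (p x z • gradEst X Ft p x z) u :=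
    fun x hx u => ((S.meas_density x hx).smul (S.measurable_gradEst hx)).inner measurable_const
  have hK : ∀ x ∈ X, ∫⁻ z, ‖innerSL ℝ (p x z • gradEst X Ft p x z)‖ₑ ∂ν ≤
      ENNReal.ofReal (1 + (G + B * Gp) ^ 2) := fun x hx => by
    refine le_of_eq_of_le (lintegral_congr fun z => ?_)
      (S.lintegral_density_smul_gradEst_le hGp hF h hx)
    rw [← ofReal_norm, ← ofReal_norm, innerSL_apply_norm]
  refine grad_eq_of_hasFDerivWithinAt S.uniqueDiffOn hx
    (hasFDerivWithinAt_of_integral_between S.convex_dom (K := 1 + L ^ 2) (by positivity)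
      (fun x hx y hy => S.norm_meanGrad_sub_le hGp hF h hL hx hy) (fun x hx y hy => ?_) hx)
  -- Fubini for F̃p: integrating over z first turns the double integral into the integral of
  -- `meanGrad` along the segment.
  have := integral_prod_fderiv_between S.convex_dom
    (fun z x hx => S.hasFDerivWithinAt_fun_mul_density z hx) hc hm hK
    (fun x hx => S.integrable_fun_mul_density hF hx) hx hy
  rw [hobj x hx, hobj y hy, ← this,
    integral_prod _ (integrable_fderiv_between S.convex_dom hc hm hK hx hy)]
  refine integral_congr_ae (Filter.Eventually.of_forall fun a => ?_)
  have ha := between_mem S.convex_dom hx hy a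
  simp only [innerSL_apply_apply]
  rw [meanGrad, S.integral_law ha, real_inner_comm,
    ← integral_inner (S.integrable_density_smul_gradEst hGp hF h ha)]
  simp_rw [real_inner_comm (y - x)]

/-! ### The joint law of (a, z(a)) along a segment -/

theorem measurable_density_between (S : Setting ν X C Ft p) {x y : Vec d} (hx : x ∈ X)
    (hy : y ∈ X) : Measurable fun s : unitInterval × Z => p (between x y s.1) s.2 :=
  measurable_comp_of_continuousOn S.continuousOn_density S.meas_density
    ((continuous_between.comp (continuous_const.prodMk
      (continuous_const.prodMk continuous_id))).measurable.comp measurable_fst)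
    (fun s => between_mem S.convex_dom hx hy s.1) measurable_snd

theorem measurable_hessEst_between (S : Setting ν X C Ft p) {x y : Vec d} (hx : x ∈ X)
    (hy : y ∈ X) : Measurable fun s : unitInterval × Z =>
      hessEst X Ft p (between x y s.1) s.2 (y - x) :=
  (ContinuousLinearMap.apply ℝ (Vec d) (y - x)).continuous.measurable.comp
    (measurable_comp_of_continuousOn S.continuousOn_hessEst
      (fun _ hx => S.measurable_hessEst hx)
    ((continuous_between.comp (continuous_const.prodMk
      (continuous_const.prodMk continuous_id))).measurable.comp measurable_fst)
    (fun s => between_mem S.convex_dom hx hy s.1) measurable_snd)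

theorem lintegral_sampleLaw [SigmaFinite ν] (S : Setting ν X C Ft p) {x y : Vec d} (hx : x ∈ X)
    (hy : y ∈ X) {f : unitInterval × Z → ENNReal} (hf : Measurable f) :
    ∫⁻ s, f s ∂(sampleLaw ν p x y) =
      ∫⁻ a : unitInterval, ∫⁻ z, f (a, z) ∂(law ν p (between x y a)) := by
  have hp := (S.measurable_density_between hx hy).ennreal_ofReal
  rw [sampleLaw, lintegral_withDensity_eq_lintegral_mul _ hp hf,
    lintegral_prod _ (hp.mul hf).aemeasurable]
  refine lintegral_congr fun a => ?_
  exact (S.lintegral_law (between_mem S.convex_dom hx hy a)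
    (hf.comp measurable_prodMk_left)).symm

theorem isProbabilityMeasure_sampleLaw [SigmaFinite ν] (S : Setting ν X C Ft p) {x y : Vec d}
    (hx : x ∈ X) (hy : y ∈ X) : IsProbabilityMeasure (sampleLaw ν p x y) := by
  constructor
  rw [← lintegral_one, S.lintegral_sampleLaw hx hy measurable_const]
  have : ∀ a : unitInterval, ∫⁻ _, 1 ∂(law ν p (between x y a)) = 1 := fun a => by
    have := S.isProbabilityMeasure_law (between_mem S.convex_dom hx hy a)
    simp
  simp_rw [this]
  simp

theorem lintegral_sq_hessEst_between_le [SigmaFinite ν] (S : Setting ν X C Ft p) (hGp : 0 ≤ Gp)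
    (hF : FunctionBounds X Ft B G LF) (h : DensityBounds ν X p Gp Lp)
    (hL : 4 * B ^ 2 * Gp ^ 4 + 16 * G ^ 2 * Gp ^ 2 + 4 * LF ^ 2 + 4 * B ^ 2 * Lp ^ 2 ≤ L ^ 2)
    {x y : Vec d} (hx : x ∈ X) (hy : y ∈ X) :
    ∫⁻ s, ENNReal.ofReal (‖hessEst X Ft p (between x y s.1) s.2 (y - x)‖ ^ 2)
      ∂(sampleLaw ν p x y) ≤ ENNReal.ofReal (L ^ 2 * ‖y - x‖ ^ 2) := by
  rw [S.lintegral_sampleLaw hx hy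
    ((S.measurable_hessEst_between hx hy).norm.pow_const 2).ennreal_ofReal]
  calc _ ≤ ∫⁻ _ : unitInterval, ENNReal.ofReal (L ^ 2 * ‖y - x‖ ^ 2) := by
        refine lintegral_mono fun a => ?_
        have ha := between_mem S.convex_dom hx hy a
        calc _ ≤ ∫⁻ z, ENNReal.ofReal (‖hessEst X Ft p (between x y a) z‖ ^ 2) *
                ENNReal.ofReal (‖y - x‖ ^ 2) ∂(law ν p (between x y a)) := by
              refine lintegral_mono fun z => ?_
              rw [← ENNReal.ofReal_mul (by positivity), ← mul_pow]
              exact ENNReal.ofReal_le_ofReal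
                (pow_le_pow_left₀ (norm_nonneg _) (ContinuousLinearMap.le_opNorm _ _) 2)
          _ ≤ _ := by
              rw [lintegral_mul_const' _ _ ENNReal.ofReal_ne_top,
                ENNReal.ofReal_mul (by positivity)]
              gcongr
              exact S.lintegral_sq_hessEst_le hGp hF h hL ha
    _ = _ := by simp

/-- The Hessian estimate along a segment is an unbiased estimate of the gradient increment. -/
theorem integral_hessEst_between [SigmaFinite ν] (S : Setting ν X C Ft p) (hGp : 0 ≤ Gp)
    (hF : FunctionBounds X Ft B G LF) (h : DensityBounds ν X p Gp Lp) {x y : Vec d} (hx : x ∈ X)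
    (hy : y ∈ X) :
    ∫ s, hessEst X Ft p (between x y s.1) s.2 (y - x) ∂(sampleLaw ν p x y) =
      meanGrad ν X Ft p y - meanGrad ν X Ft p x := by
  obtain ⟨L, hL⟩ : ∃ L : ℝ,
      4 * B ^ 2 * Gp ^ 4 + 16 * G ^ 2 * Gp ^ 2 + 4 * LF ^ 2 + 4 * B ^ 2 * Lp ^ 2 ≤ L ^ 2 :=
    ⟨_, (Real.sq_sqrt (by positivity)).ge⟩
  -- The density of `sampleLaw` at (a, z) is p(z; x(a)), so the integrand becomes the derivative of
  -- p·`gradEst` along the segment.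
  rw [meanGrad, meanGrad, S.integral_law hy, S.integral_law hx,
    ← integral_prod_fderiv_between S.convex_dom
    (fun z x hx => S.hasFDerivWithinAt_density_smul_gradEst z hx)
    (fun z => (S.continuousOn_density z).smul (S.continuousOn_hessEst z))
    (fun x hx u => (ContinuousLinearMap.apply ℝ (Vec d) u).continuous.measurable.comp
      ((S.meas_density x hx).smul (S.measurable_hessEst hx)))
    (fun x hx => S.lintegral_density_smul_hessEst_le hGp hF h hL hx)
    (fun x hx => S.integrable_density_smul_gradEst hGp hF h hx) hx hy, sampleLaw,
    integral_withDensity_eq_integral_toReal_smul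
      (S.measurable_density_between hx hy).ennreal_ofReal
      (Filter.Eventually.of_forall fun _ => ENNReal.ofReal_lt_top)]
  refine integral_congr_ae (Filter.Eventually.of_forall fun s => ?_)
  simp [ENNReal.toReal_ofReal (S.density_pos _ (between_mem S.convex_dom hx hy s.1) s.2).le]

end Setting

/-! ### Markov's inequality and averages -/

/-- Markov's inequality if c > 0. If c = 0 one cannot divide by c, but then 𝔼f = 0 and f vanishes
almost surely. -/
theorem one_sub_le_measureReal_le {Ω : Type*} [MeasurableSpace Ω] (P : Measure Ω)
    [IsProbabilityMeasure P] {f : Ω → ℝ} (hf : Measurable f) (h0 : ∀ ω, 0 ≤ f ω) {c r : ℝ}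
    (hc : 0 ≤ c) (hr : 0 ≤ r) (h : ∫⁻ ω, ENNReal.ofReal (f ω) ∂P ≤ ENNReal.ofReal (r * c)) :
    1 - r ≤ P.real {ω | f ω ≤ c} := by
  rcases hc.eq_or_lt with rfl | hc
  · have hz : f =ᵐ[P] 0 := by
      have h1 : ∫⁻ ω, ENNReal.ofReal (f ω) ∂P = 0 := by simpa using h
      filter_upwards [(lintegral_eq_zero_iff hf.ennreal_ofReal).1 h1] with ω hω
      exact le_antisymm (ENNReal.ofReal_eq_zero.1 hω) (h0 ω)
    have : P {ω | f ω ≤ 0} = 1 := by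
      refine (mem_ae_iff_prob_eq_one (hf measurableSet_Iic)).1 ?_
      filter_upwards [hz] with ω hω using hω.le
    rw [measureReal_def, this]
    simpa using hr
  · obtain ⟨hi, hb⟩ := integrable_and_integral_le_of_lintegral hf h0 (by positivity) h
    have hm := mul_meas_ge_le_integral_of_nonneg (Filter.Eventually.of_forall h0) hi c
    have h1 : P.real {ω | c ≤ f ω} ≤ r := by
      refine le_of_mul_le_mul_left ?_ hc
      linarith
    have h2 : P.real {ω | f ω ≤ c}ᶜ = 1 - P.real {ω | f ω ≤ c} :=
      probReal_compl_eq_one_sub (hf measurableSet_Iic)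
    have h3 : P.real {ω | f ω ≤ c}ᶜ ≤ P.real {ω | c ≤ f ω} :=
      measureReal_mono fun ω (hω : ¬ f ω ≤ c) => (not_le.1 hω).le
    linarith

theorem average_const_sub {E : Type*} [AddCommGroup E] [Module ℝ E] {n : ℕ} (hn : 1 ≤ n) (w : E)
    (a : Fin n → E) :
    (1 / (n : ℝ)) • ∑ i, (w - a i) = w - (1 / (n : ℝ)) • ∑ i, a i := by
  have hne : (n : ℝ) ≠ 0 := by positivity
  rw [Finset.sum_sub_distrib, smul_sub, Finset.sum_const, Finset.card_univ, Fintype.card_fin,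
    ← Nat.cast_smul_eq_nsmul ℝ, smul_smul, one_div_mul_cancel hne, one_smul]

/-! ### Measurability along random points -/

namespace Setting

variable {d : ℕ} {Z : Type*} [MeasurableSpace Z] {ν : Measure Z} {X C : Set (Vec d)}
  {Ft p : Vec d → Z → ℝ} {B G LF Gp Lp L : ℝ}

theorem measurable_hessEst_comp (S : Setting ν X C Ft p) {Ω : Type*} {_ : MeasurableSpace Ω}
    {ξ η : Ω → Vec d} {ζ : Ω → unitInterval × Z} (hξ : Measurable ξ) (hη : Measurable η)
    (hζ : Measurable ζ) (hξX : ∀ ω, ξ ω ∈ X) (hηX : ∀ ω, η ω ∈ X) :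
    Measurable fun ω =>
      hessEst X Ft p (between (ξ ω) (η ω) (ζ ω).1) (ζ ω).2 (η ω - ξ ω) := by
  have h1 : Measurable fun ω => hessEst X Ft p (between (ξ ω) (η ω) (ζ ω).1) (ζ ω).2 :=
    measurable_comp_of_continuousOn S.continuousOn_hessEst
      (fun _ hx => S.measurable_hessEst hx)
      (continuous_between.measurable.comp (hξ.prodMk (hη.prodMk (measurable_fst.comp hζ))))
      (fun ω => between_mem S.convex_dom (hξX ω) (hηX ω) _) (measurable_snd.comp hζ)
  exact (isBoundedBilinearMap_apply (𝕜 := ℝ) (E := Vec d) (F := Vec d)).continuous.measurable.comp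
    (h1.prodMk (hη.sub hξ))

theorem measurable_meanGrad_comp [SigmaFinite ν] (S : Setting ν X C Ft p) (hGp : 0 ≤ Gp)
    (hF : FunctionBounds X Ft B G LF) (h : DensityBounds ν X p Gp Lp) {Ω : Type*}
    {_ : MeasurableSpace Ω} {ξ : Ω → Vec d} (hξ : Measurable ξ) (hξX : ∀ ω, ξ ω ∈ X) :
    Measurable fun ω => meanGrad ν X Ft p (ξ ω) := by
  obtain ⟨L, hL⟩ : ∃ L : ℝ,
      4 * B ^ 2 * Gp ^ 4 + 16 * G ^ 2 * Gp ^ 2 + 4 * LF ^ 2 + 4 * B ^ 2 * Lp ^ 2 ≤ L ^ 2 :=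
    ⟨_, (Real.sq_sqrt (by positivity)).ge⟩
  have hc : ContinuousOn (meanGrad ν X Ft p) X := by
    refine (LipschitzOnWith.of_dist_le_mul (K := ⟨1 + L ^ 2, by positivity⟩)
      fun x hx y hy => ?_).continuousOn
    rw [dist_eq_norm, dist_eq_norm]
    exact S.norm_meanGrad_sub_le hGp hF h hL hy hx
  -- A function of x alone is a Carathéodory function over a one-point space.
  exact measurable_comp_of_continuousOn (Z := Unit) (φ := fun x _ => meanGrad ν X Ft p x)
    (fun _ => hc) (fun _ _ => measurable_const) hξ hξX (measurable_const (a := ()))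

theorem measurable_sampleLaw [SigmaFinite ν] (S : Setting ν X C Ft p) {Ω : Type*}
    [MeasurableSpace Ω] {ξ η : Ω → Vec d} (hξ : Measurable ξ) (hη : Measurable η)
    (hξX : ∀ ω, ξ ω ∈ X) (hηX : ∀ ω, η ω ∈ X) :
    Measurable fun ω => sampleLaw ν p (ξ ω) (η ω) := by
  refine Measure.measurable_of_measurable_coe _ fun A hA => ?_
  simp_rw [sampleLaw, withDensity_apply _ hA]
  have h : Measurable fun q : Ω × unitInterval × Z =>
      p (between (ξ q.1) (η q.1) q.2.1) q.2.2 :=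
    measurable_comp_of_continuousOn S.continuousOn_density S.meas_density
      (continuous_between.measurable.comp ((hξ.comp measurable_fst).prodMk
        ((hη.comp measurable_fst).prodMk (measurable_fst.comp measurable_snd))))
      (fun q => between_mem S.convex_dom (hξX _) (hηX _) _)
      (measurable_snd.comp measurable_snd)
  exact h.ennreal_ofReal.lintegral_prod_right'

end Setting

/-! ### Mean square error along a run -/

namespace IsRun

variable {d : ℕ} {Z : Type*} [MeasurableSpace Z] {Ω : Type*} [MeasurableSpace Ω]
  {ν : Measure Z} {X C : Set (Vec d)} {Ft p : Vec d → Z → ℝ} {T m₀ : ℕ} {m : ℕ → ℕ}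
  {P : Measure Ω} {𝓕 : Filtration ℕ ‹MeasurableSpace Ω›} {M₀ : Fin m₀ → Ω → Z}
  {M : (t : ℕ) → Fin (m t) → Ω → unitInterval × Z} {x g v : ℕ → Ω → Vec d}
  {D B G LF Gp Lp L : ℝ}

/-- x_t is an average of T points of X: the directions v_i with i < t, and the origin for the other
indices. -/
theorem iterate_mem (R : IsRun ν X C Ft p T m₀ m P 𝓕 M₀ M x g v) (S : Setting ν X C Ft p)
    {t : ℕ} (ht : t ≤ T) (ω : Ω) : x t ω ∈ X := by
  have hsum : ∀ t ≤ T, x t ω =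
      ∑ i ∈ Finset.range T, (1 / (T : ℝ)) • (if i < t then v i ω else 0) := by
    intro t
    induction t with
    | zero => intro _; simp [R.start ω]
    | succ t ih =>
      intro ht
      rw [R.step t ht ω, ih (by omega), ← Finset.add_sum_erase _ _ (Finset.mem_range.2 ht),
        ← Finset.add_sum_erase (a := t) _ _ (Finset.mem_range.2 ht)]
      simp only [lt_irrefl, if_false, smul_zero, zero_add, Nat.lt_succ_self, if_true]
      rw [add_comm]
      congr 1
      refine Finset.sum_congr rfl fun i hi => ?_
      have : i ≠ t := (Finset.mem_erase.1 hi).1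
      have : i < t ↔ i < t + 1 := by omega
      simp only [this]
  rcases Nat.eq_zero_or_pos T with rfl | hT
  · rw [hsum t ht]; simpa using S.zero_mem
  rw [hsum t ht]
  refine S.convex_dom.sum_mem (fun i _ => by positivity) ?_ fun i hi => ?_
  · have : (T : ℝ) ≠ 0 := by positivity
    simp [this]
  · split_ifs
    · exact S.subset_dom (R.dir_mem i (Finset.mem_range.1 hi) ω)
    · exact S.zero_mem

theorem norm_iterate_sub_le (R : IsRun ν X C Ft p T m₀ m P 𝓕 M₀ M x g v)
    (hD : DiameterBound C D) {t : ℕ} (ht : t < T) (ω : Ω) :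
    ‖x (t + 1) ω - x t ω‖ ≤ D / T := by
  rw [R.step t ht ω, add_sub_cancel_left, norm_smul, Real.norm_of_nonneg (by positivity),
    one_div_mul_eq_div]
  gcongr
  simpa using hD _ (Set.mem_insert_of_mem _ (R.dir_mem t ht ω)) 0 (Set.mem_insert _ _)

/-- x_{t+1} is already known after iteration t, so the segment from x_t to x_{t+1} is fixed before
batch t + 1 is drawn. -/
theorem measurable_iterate (R : IsRun ν X C Ft p T m₀ m P 𝓕 M₀ M x g v) {t : ℕ} (ht : t < T) :
    Measurable[𝓕 t] (x t) ∧ Measurable[𝓕 t] (x (t + 1)) := by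
  have hstep : ∀ t < T, Measurable[𝓕 t] (x t) → Measurable[𝓕 t] (x (t + 1)) := fun t ht h => by
    rw [show x (t + 1) = fun ω => x t ω + (1 / (T : ℝ)) • v t ω from funext (R.step t ht)]
    exact h.add ((R.meas_dir t ht).fun_const_smul _)
  induction t with
  | zero =>
    have h0 : Measurable[𝓕 0] (x 0) := by
      rw [show x 0 = fun _ => 0 from funext R.start]
      exact measurable_const
    exact ⟨h0, hstep 0 ht h0⟩
  | succ t ih =>
    have h := ((ih (by omega)).2).mono (𝓕.mono t.le_succ) le_rfl
    exact ⟨h, hstep _ ht h⟩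

theorem measurable_estimate (R : IsRun ν X C Ft p T m₀ m P 𝓕 M₀ M x g v)
    (S : Setting ν X C Ft p) {t : ℕ} (ht : t < T) : Measurable[𝓕 t] (g t) := by
  induction t with
  | zero =>
    rw [show g 0 = fun ω => (1 / (m₀ : ℝ)) • ∑ i, gradEst X Ft p 0 (M₀ i ω) from
      funext fun ω => by rw [R.est_zero ω, R.start ω]]
    exact (Finset.measurable_sum _ fun i _ =>
      (S.measurable_gradEst S.zero_mem).comp (R.meas_first i)).fun_const_smul _
  | succ t ih =>
    have hle := 𝓕.mono t.le_succ
    have h1 := (R.measurable_iterate (t := t) (by omega)).1.mono hle le_rfl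
    have h2 := (R.measurable_iterate (t := t) (by omega)).2.mono hle le_rfl
    have h3 := (ih (by omega)).mono hle le_rfl
    rw [show g (t + 1) = fun ω => g t ω + (1 / (m (t + 1) : ℝ)) • ∑ i, hessEst X Ft p
        (between (x t ω) (x (t + 1) ω) (M (t + 1) i ω).1) (M (t + 1) i ω).2
        (x (t + 1) ω - x t ω) from funext fun ω => by
      rw [R.est_succ t ht ω]; simp]
    exact h3.add ((Finset.measurable_sum _ fun i _ =>
      S.measurable_hessEst_comp h1 h2 (R.meas_batch (t + 1) (by omega) ht i)
        (R.iterate_mem S (by omega)) (R.iterate_mem S (by omega))).fun_const_smul _)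

theorem measurable_error [SigmaFinite ν] (R : IsRun ν X C Ft p T m₀ m P 𝓕 M₀ M x g v)
    (S : Setting ν X C Ft p) (hGp : 0 ≤ Gp) (hF : FunctionBounds X Ft B G LF)
    (h : DensityBounds ν X p Gp Lp) {t : ℕ} (ht : t < T) :
    Measurable[𝓕 t] fun ω => meanGrad ν X Ft p (x t ω) - g t ω :=
  (S.measurable_meanGrad_comp hGp hF h (R.measurable_iterate ht).1 (R.iterate_mem S ht.le)).sub
    (R.measurable_estimate S ht)

/-- The averaging bound with c = 0: the first error is a pure average of centred samples. -/
theorem lintegral_sq_error_zero_le (R : IsRun ν X C Ft p T m₀ m P 𝓕 M₀ M x g v)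
    (S : Setting ν X C Ft p) (hGp : 0 ≤ Gp) (hF : FunctionBounds X Ft B G LF)
    (h : DensityBounds ν X p Gp Lp) (hm₀ : 1 ≤ m₀) :
    ∫⁻ ω, ENNReal.ofReal (‖meanGrad ν X Ft p (x 0 ω) - g 0 ω‖ ^ 2) ∂P ≤
      ENNReal.ofReal ((G + B * Gp) ^ 2 / m₀) := by
  have := S.isProbabilityMeasure_law S.zero_mem
  set W := gradEst X Ft p 0 with hW
  have hWm : Measurable W := S.measurable_gradEst S.zero_mem
  have key := lintegral_norm_add_average_sq_le hWm (by positivity)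
    (S.lintegral_sq_gradEst_le hGp hF h S.zero_mem) 0 m₀ hm₀
  have hM : Measurable fun ω i => M₀ i ω :=
    measurable_pi_lambda _ fun i => (R.meas_first i).mono (𝓕.le 0) le_rfl
  have hΦ : Measurable fun s : Fin m₀ → Z => ENNReal.ofReal
      (‖(0 : Vec d) + (1 / (m₀ : ℝ)) • ∑ i, ((∫ r, W r ∂(law ν p 0)) - W (s i))‖ ^ 2) :=
    ((measurable_const.add ((Finset.measurable_sum _ fun i _ =>
      (hWm.comp (measurable_pi_apply i)).const_sub _).fun_const_smul _)).norm.pow_const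
        2).ennreal_ofReal
  rw [← R.law_first, lintegral_map hΦ hM] at key
  have herr : ∀ ω, meanGrad ν X Ft p (x 0 ω) - g 0 ω =
      0 + (1 / (m₀ : ℝ)) • ∑ i, ((∫ r, W r ∂(law ν p 0)) - W (M₀ i ω)) := fun ω => by
    rw [average_const_sub hm₀, zero_add, R.est_zero ω, R.start ω, meanGrad]
  simp_rw [herr]
  simpa using key

/-- Condition on 𝓕 t: the old error is then a constant, and the batch adds an independent centred
average to it. -/
theorem lintegral_sq_error_succ_le [SigmaFinite ν] [IsProbabilityMeasure P]
    (R : IsRun ν X C Ft p T m₀ m P 𝓕 M₀ M x g v)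
    (S : Setting ν X C Ft p) (hD : DiameterBound C D) (hGp : 0 ≤ Gp)
    (hF : FunctionBounds X Ft B G LF) (h : DensityBounds ν X p Gp Lp)
    (hL : 4 * B ^ 2 * Gp ^ 4 + 16 * G ^ 2 * Gp ^ 2 + 4 * LF ^ 2 + 4 * B ^ 2 * Lp ^ 2 ≤ L ^ 2)
    {t : ℕ} (ht : t + 1 < T) (hm : 1 ≤ m (t + 1)) :
    ∫⁻ ω, ENNReal.ofReal (‖meanGrad ν X Ft p (x (t + 1) ω) - g (t + 1) ω‖ ^ 2) ∂P ≤
      ∫⁻ ω, ENNReal.ofReal (‖meanGrad ν X Ft p (x t ω) - g t ω‖ ^ 2) ∂P +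
        ENNReal.ofReal (L ^ 2 * (D / T) ^ 2) := by
  have ht' : t < T := by omega
  have hxX : ∀ ω, x t ω ∈ X := R.iterate_mem S (by omega)
  have hyX : ∀ ω, x (t + 1) ω ∈ X := R.iterate_mem S (by omega)
  obtain ⟨hxm, hym⟩ := R.measurable_iterate ht'
  have hem := R.measurable_error S hGp hF h ht'
  set n := m (t + 1) with hn
  -- The state at time t on which the batch law depends, together with the old error. The subtype X
  -- makes `κ` a probability measure at every state.
  let σ : Ω → X × X × Vec d := fun ω =>
    (⟨x t ω, hxX ω⟩, ⟨x (t + 1) ω, hyX ω⟩, meanGrad ν X Ft p (x t ω) - g t ω)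
  have hσ : Measurable[𝓕 t] σ := (hxm.subtype_mk).prodMk ((hym.subtype_mk).prodMk hem)
  let κ : X × X × Vec d → Measure (Fin n → unitInterval × Z) := fun w =>
    Measure.pi fun _ => sampleLaw ν p w.1 w.2.1
  have hprob : ∀ w : X × X × Vec d, IsProbabilityMeasure (sampleLaw ν p (w.1 : Vec d) w.2.1) :=
    fun w => S.isProbabilityMeasure_sampleLaw w.1.2 w.2.1.2
  have hw1 : Measurable fun w : X × X × Vec d => (w.1 : Vec d) :=
    measurable_subtype_coe.comp measurable_fst
  have hw2 : Measurable fun w : X × X × Vec d => (w.2.1 : Vec d) :=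
    measurable_subtype_coe.comp (measurable_fst.comp measurable_snd)
  have hκ : Measurable κ := measurable_measure_pi n
    (S.measurable_sampleLaw hw1 hw2 (fun w => w.1.2) (fun w => w.2.1.2))
  have hκp : ∀ w, IsProbabilityMeasure (κ w) := fun w => by
    have := hprob w
    exact inferInstanceAs (IsProbabilityMeasure (Measure.pi _))
  have hM : Measurable fun ω i => M (t + 1) i ω :=
    measurable_pi_lambda _ fun i => (R.meas_batch (t + 1) (by omega) ht i).mono (𝓕.le _) le_rfl
  let Q : X × X × Vec d → unitInterval × Z → Vec d := fun w s =>
    hessEst X Ft p (between w.1 w.2.1 s.1) s.2 (w.2.1 - w.1)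
  let Φ : (X × X × Vec d) × (Fin n → unitInterval × Z) → ENNReal := fun q =>
    ENNReal.ofReal (‖q.1.2.2 + (1 / (n : ℝ)) • ∑ i,
      ((meanGrad ν X Ft p q.1.2.1 - meanGrad ν X Ft p q.1.1) - Q q.1 (q.2 i))‖ ^ 2)
  have hΦ : Measurable Φ := by
    have k1 : Measurable fun q : (X × X × Vec d) × (Fin n → unitInterval × Z) =>
        (q.1.1 : Vec d) := hw1.comp measurable_fst
    have k2 : Measurable fun q : (X × X × Vec d) × (Fin n → unitInterval × Z) =>
        (q.1.2.1 : Vec d) := hw2.comp measurable_fst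
    refine (((measurable_snd.comp (measurable_snd.comp measurable_fst)).add
      ((Finset.measurable_sum _ fun i _ => Measurable.sub (Measurable.sub ?_ ?_)
        ?_).fun_const_smul _)).norm.pow_const 2).ennreal_ofReal
    · exact S.measurable_meanGrad_comp hGp hF h k2 fun q => q.1.2.1.2
    · exact S.measurable_meanGrad_comp hGp hF h k1 fun q => q.1.1.2
    · exact S.measurable_hessEst_comp k1 k2 ((measurable_pi_apply i).comp measurable_snd)
        (fun q => q.1.1.2) (fun q => q.1.2.1.2)
  have hcond := lintegral_comp_of_condLaw P (hσ.mono (𝓕.le t) le_rfl) hM hκ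
    (fun A hA U hU => R.law_batch t ht _ (hσ hA) U hU) hΦ
  -- e_{t+1} equals e_t plus the true gradient increment minus the batch average.
  have herr : ∀ ω, ENNReal.ofReal (‖meanGrad ν X Ft p (x (t + 1) ω) - g (t + 1) ω‖ ^ 2) =
      Φ (σ ω, fun i => M (t + 1) i ω) := fun ω => by
    simp only [Φ, Q, σ]
    rw [average_const_sub hm, R.est_succ t ht ω, smul_apply, sum_apply]
    congr 3
    abel
  have hconst : ENNReal.ofReal (L ^ 2 * (D / T) ^ 2) =
      ∫⁻ _, ENNReal.ofReal (L ^ 2 * (D / T) ^ 2) ∂P := by simp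
  rw [lintegral_congr herr, hcond, hconst, ← lintegral_add_right _ measurable_const]
  refine lintegral_mono fun ω => ?_
  have := hprob (σ ω)
  have hstep := R.norm_iterate_sub_le hD ht' ω
  have key := lintegral_norm_add_average_sq_le
    (S.measurable_hessEst_between (hxX ω) (hyX ω)) (by positivity)
    (S.lintegral_sq_hessEst_between_le hGp hF h hL (hxX ω) (hyX ω))
    (meanGrad ν X Ft p (x t ω) - g t ω) n hm
  rw [S.integral_hessEst_between hGp hF h (hxX ω) (hyX ω)] at key
  refine key.trans ?_
  rw [← ENNReal.ofReal_add (by positivity) (by positivity)]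
  refine ENNReal.ofReal_le_ofReal ?_
  gcongr
  -- The gain 1/n is discarded: over at most T steps the increments L²D²/T² stay summable to L²D²/T.
  calc L ^ 2 * ‖x (t + 1) ω - x t ω‖ ^ 2 / n ≤ L ^ 2 * ‖x (t + 1) ω - x t ω‖ ^ 2 :=
        div_le_self (by positivity) (by exact_mod_cast hm)
    _ ≤ _ := by gcongr

theorem lintegral_sq_error_le [SigmaFinite ν] [IsProbabilityMeasure P]
    (R : IsRun ν X C Ft p T m₀ m P 𝓕 M₀ M x g v)
    (S : Setting ν X C Ft p) (hD : DiameterBound C D) (hGp : 0 ≤ Gp)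
    (hF : FunctionBounds X Ft B G LF) (h : DensityBounds ν X p Gp Lp)
    (hL : 4 * B ^ 2 * Gp ^ 4 + 16 * G ^ 2 * Gp ^ 2 + 4 * LF ^ 2 + 4 * B ^ 2 * Lp ^ 2 ≤ L ^ 2)
    (hm : ∀ t, 1 ≤ t → t < T → 1 ≤ m t)
    (hm₀ : 1 ≤ m₀) (hm₀' : (G + B * Gp) ^ 2 ≤ (m₀ : ℝ) * (L ^ 2 * D ^ 2)) {t : ℕ} (ht : t < T) :
    ∫⁻ ω, ENNReal.ofReal (‖meanGrad ν X Ft p (x t ω) - g t ω‖ ^ 2) ∂P ≤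
      ENNReal.ofReal (L ^ 2 * D ^ 2 + t * (L ^ 2 * (D / T) ^ 2)) := by
  induction t with
  | zero =>
    refine (R.lintegral_sq_error_zero_le S hGp hF h hm₀).trans (ENNReal.ofReal_le_ofReal ?_)
    have : (0 : ℝ) < m₀ := by positivity
    rw [div_le_iff₀ this]
    simpa [mul_comm] using hm₀'
  | succ t ih =>
    refine (R.lintegral_sq_error_succ_le S hD hGp hF h hL ht
      (hm _ (by omega) ht)).trans ?_
    refine (add_le_add_left (ih (by omega)) _).trans ?_
    rw [← ENNReal.ofReal_add (by positivity) (by positivity)]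
    refine ENNReal.ofReal_le_ofReal (le_of_eq ?_)
    push_cast
    ring

end IsRun

end SCGPlus

/-! ### The high-probability bound -/

theorem lemma2 {d : ℕ} {Z : Type*} [MeasurableSpace Z] {Ω : Type*} [MeasurableSpace Ω]
    (P : Measure Ω) [IsProbabilityMeasure P]
    (ν : Measure Z) [SigmaFinite ν]
    (X C : Set (SCGPlus.Vec d)) (Ft p : SCGPlus.Vec d → Z → ℝ)
    (hset : SCGPlus.Setting ν X C Ft p)
    (D B G LF Gp Lp L2F L2p : ℝ) (hGp : 0 ≤ Gp)
    (h1 : SCGPlus.DiameterBound C D)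
    (h5 : 0 ≤ SCGPlus.objective ν Ft p 0)
    (h6 : SCGPlus.FunctionBounds X Ft B G LF)
    (h7 : SCGPlus.DensityBounds ν X p Gp Lp)
    (h8 : SCGPlus.HessianLipschitz X Ft p L2F L2p)
    (L : ℝ)
    (hL : 4 * B ^ 2 * Gp ^ 4 + 16 * G ^ 2 * Gp ^ 2 + 4 * LF ^ 2 + 4 * B ^ 2 * Lp ^ 2 ≤ L ^ 2)
    (T m₀ : ℕ) (m : ℕ → ℕ) (hT : 2 ≤ T) (hm : ∀ t, 1 ≤ t → t < T → 1 ≤ m t)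
    (hm₀ : 1 ≤ m₀) (hm₀' : (G + B * Gp) ^ 2 ≤ (m₀ : ℝ) * (L ^ 2 * D ^ 2))
    (𝓕 : Filtration ℕ ‹MeasurableSpace Ω›)
    (M₀ : Fin m₀ → Ω → Z) (M : (t : ℕ) → Fin (m t) → Ω → unitInterval × Z)
    (x g v : ℕ → Ω → SCGPlus.Vec d)
    (hrun : SCGPlus.IsRun ν X C Ft p T m₀ m P 𝓕 M₀ M x g v)
    (δ : ℝ) (hδ : 0 < δ) :
    1 - (T : ℝ) / δ ^ 2 ≤
      P.real {ω | ∑ t ∈ Finset.range T,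
          ‖SCGPlus.grad X (SCGPlus.objective ν Ft p) (x t ω) - g t ω‖ ^ 2 ≤
        δ ^ 2 * ∑ t ∈ Finset.Ico 1 T, 2 * L ^ 2 * D ^ 2 / (t : ℝ) ^ 2} := by
  have hgrad : ∀ ω, ∑ t ∈ Finset.range T,
        ‖SCGPlus.grad X (SCGPlus.objective ν Ft p) (x t ω) - g t ω‖ ^ 2 =
      ∑ t ∈ Finset.range T, ‖SCGPlus.meanGrad ν X Ft p (x t ω) - g t ω‖ ^ 2 := fun ω =>
    Finset.sum_congr rfl fun t ht => by
      rw [hset.grad_objective hGp h6 h7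
        (hrun.iterate_mem hset (Finset.mem_range.1 ht).le ω)]
  have hmeas : ∀ t ∈ Finset.range T, Measurable fun ω =>
      ‖SCGPlus.meanGrad ν X Ft p (x t ω) - g t ω‖ ^ 2 := fun t ht =>
    (((hrun.measurable_error hset hGp h6 h7 (Finset.mem_range.1 ht)).mono (𝓕.le t)
      le_rfl).norm).pow_const 2
  simp_rw [hgrad]
  refine SCGPlus.one_sub_le_measureReal_le P (Finset.measurable_sum _ hmeas)
    (fun ω => by positivity) (by positivity) (by positivity) ?_
  have hT0 : (0 : ℝ) < T := by positivity
  -- Only the term t = 1 is kept; it is present because T ≥ 2.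
  have hS : 2 * L ^ 2 * D ^ 2 ≤ ∑ t ∈ Finset.Ico 1 T, 2 * L ^ 2 * D ^ 2 / (t : ℝ) ^ 2 := by
    refine le_of_eq_of_le ?_ (Finset.single_le_sum (a := 1)
      (f := fun t : ℕ => 2 * L ^ 2 * D ^ 2 / (t : ℝ) ^ 2) (fun t _ => by positivity)
      (Finset.mem_Ico.2 ⟨le_rfl, by omega⟩))
    simp
  simp_rw [ENNReal.ofReal_sum_of_nonneg fun (t : ℕ) (_ : t ∈ Finset.range T) =>
    sq_nonneg ‖SCGPlus.meanGrad ν X Ft p (x t _) - g t _‖]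
  rw [lintegral_finsetSum' _ fun t ht => (hmeas t ht).ennreal_ofReal.aemeasurable]
  calc _ ≤ ∑ t ∈ Finset.range T, ENNReal.ofReal (2 * L ^ 2 * D ^ 2) := by
        refine Finset.sum_le_sum fun t ht => ?_
        have ht' := Finset.mem_range.1 ht
        refine (hrun.lintegral_sq_error_le hset h1 hGp h6 h7 hL hm hm₀ hm₀' ht').trans
          (ENNReal.ofReal_le_ofReal ?_)
        -- From t ≤ T ≤ T²; the accumulated increments thus at most double the initial bound.
        have hfrac : (t : ℝ) / T ^ 2 ≤ 1 := by
          rw [div_le_one (by positivity)]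
          have h2 : (t : ℝ) ≤ T := by exact_mod_cast ht'.le
          have h3 : (1 : ℝ) ≤ T := by exact_mod_cast (by omega : 1 ≤ T)
          nlinarith
        calc L ^ 2 * D ^ 2 + t * (L ^ 2 * (D / T) ^ 2)
            = L ^ 2 * D ^ 2 + L ^ 2 * D ^ 2 * (t / T ^ 2) := by ring
          _ ≤ L ^ 2 * D ^ 2 + L ^ 2 * D ^ 2 * 1 := by gcongr
          _ = _ := by ring
    _ = ENNReal.ofReal (T * (2 * L ^ 2 * D ^ 2)) := by
        rw [ENNReal.ofReal_mul hT0.le]; simp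
    _ ≤ _ := by
        refine ENNReal.ofReal_le_ofReal ?_
        -- Markov's inequality is used with ratio T/δ² and threshold δ²Σ, whose product is TΣ.
        rw [← mul_assoc (_ / _), div_mul_cancel₀ _ (by positivity)]
        gcongr
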